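/- Let $K$ be a field, $n,d\ge 1$ integers, $S=K[x_1,\dots,x_n]$ the standard graded polynomial ring, $\mathfrak m=(x_1,\dots,x_n)$, and let $I=I_{n,d}\subset S$ be the squarefree Veronese ideal of degree $d$, i.e. the ideal generated by all squarefree monomials of degree $d$ (so $I=0$ if $d>n$). For $k\ge1$ let $I^{(k)}=\bigcap_{P\in\mathrm{Ass}(S/I)}(I^kS_P\cap S)$ be the $k$-th symbolic power of $I$. Then: (a) For all $k\ge1$, the ideal $I^{(k)}$ has linear quotients, and it is componentwise linear. (b) If $d\le n$, then $\operatorname{reg} I^{(k)}=\operatorname{reg} I^k=dk$ for all $k\ge 1$. Here a monomial ideal $J\subset S$ has linear quotients if its minimal monomial generators can be ordered as $u_1,\dots,u_m$ such that for each $i=2,\dots,m$ the colon ideal $(u_1,\dots,u_{i-1}):(u_i)$ is generated by variables. A homogeneous ideal $J$ has a linear resolution if, for some $j$, the $i$-th module of its minimal graded free resolution is generated in degree $j+i$ for every $i\ge0$ (the zero ideal is counted as having a linear resolution); $J$ is componentwise linear if for every $j$ the ideal $J_{\langle j\rangle}$ generated by the homogeneous elements of degree $j$ of $J$ has a linear resolution.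 The Castelnuovo–Mumford regularity of $J$ is $\operatorname{reg} J=\sup\{a-i\}$, where $a$ runs through the degrees of the basis elements of the $i$-th free module in the minimal graded free resolution of $J$ and $i$ runs through all $i\ge 0$. -/

import Mathlib

/-- The squarefree Veronese ideal `I_{n,d}`: the ideal of `K[x_1, …, x_n]` generated by all
squarefree monomials of degree `d`. -/
noncomputable def squarefreeVeronese (K : Type*) [Field K] (n d : ℕ) : Ideal (MvPolynomial (Fin n) K) :=
  Ideal.span {f | ∃ A : Finset (Fin n), A.card = d ∧ f = ∏ i ∈ A, MvPolynomial.X i}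

/-- The `k`-th symbolic power `I^(k) = ⋂_{P ∈ Ass(I)} (I^k R_P ∩ R)`, where `Ass(I)` is the set of
associated primes of the `R`-module `R / I`. -/
noncomputable def symbolicPower {R : Type*} [CommRing R] (I : Ideal R) (k : ℕ) : Ideal R :=
  ⨅ P : associatedPrimes R (R ⧸ I),
    ((I ^ k).map (algebraMap R (Localization.AtPrime P.1))).comap
      (algebraMap R (Localization.AtPrime P.1))

section MonomialIdeals

variable {K : Type*} [Field K] {n : ℕ}

/-- The exponent vectors of the minimal monomial generators of a monomial ideal `I`: the
monomials of `I` that are minimal with respect to divisibility. -/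
def minimalMonomials (I : Ideal (MvPolynomial (Fin n) K)) : Set (Fin n →₀ ℕ) :=
  {a | Minimal (fun b : Fin n →₀ ℕ => MvPolynomial.monomial b (1 : K) ∈ I) a}

/-- `I` is generated by monomials. -/
def IsMonomialIdeal (I : Ideal (MvPolynomial (Fin n) K)) : Prop :=
  ∃ s : Set (Fin n →₀ ℕ), I = Ideal.span ((fun a => MvPolynomial.monomial a (1 : K)) '' s)

/-- A monomial ideal `I` has linear quotients if its minimal monomial generators can be ordered as
`u_1, …, u_m` in such a way that every colon ideal `(u_1, …, u_{i-1}) : (u_i)` is generated by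
variables. (The first of these colon ideals is zero, generated by the empty set.) -/
def HasLinearQuotients (I : Ideal (MvPolynomial (Fin n) K)) : Prop :=
  IsMonomialIdeal I ∧
  ∃ (m : ℕ) (u : Fin m → (Fin n →₀ ℕ)),
    Function.Injective u ∧ Set.range u = minimalMonomials I ∧
    ∀ i : Fin m, ∃ A : Set (Fin n),
      (Ideal.span {f | ∃ j < i, f = MvPolynomial.monomial (u j) (1 : K)}).colon
          {MvPolynomial.monomial (u i) (1 : K)} =
        Ideal.span (MvPolynomial.X '' A)

end MonomialIdeals

section Resolutions

variable {K : Type*} [Field K] {n : ℕ}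

/-- A graded free resolution `⋯ → F_1 → F_0 → I → 0` of an ideal `I` of the standard graded
polynomial ring `S = K[x_1, …, x_n]` by free modules of finite rank. The module `F_i` is free on
the basis `ι i`, the basis element `e` being placed in degree `deg i e`, so that
`F_i = ⨁_e S(-deg i e)`. The last two fields say that all maps are homogeneous of degree zero. -/
structure GradedFreeResolution (I : Ideal (MvPolynomial (Fin n) K)) where
  /-- The homogeneous basis of `F_i`. -/
  ι : ℕ → Type
  finite_basis : ∀ i, Finite (ι i)
  /-- The degrees of the basis elements. -/
  deg : ∀ i, ι i → ℤ
  /-- The augmentation `F_0 → I ⊆ S`. -/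
  aug : (ι 0 →₀ MvPolynomial (Fin n) K) →ₗ[MvPolynomial (Fin n) K] MvPolynomial (Fin n) K
  /-- The differential `F_{i+1} → F_i`. -/
  d : ∀ i, (ι (i + 1) →₀ MvPolynomial (Fin n) K) →ₗ[MvPolynomial (Fin n) K]
    (ι i →₀ MvPolynomial (Fin n) K)
  range_aug : LinearMap.range aug = I
  exact_zero : Function.Exact (d 0) aug
  exact_succ : ∀ i, Function.Exact (d (i + 1)) (d i)
  homogeneous_aug : ∀ e, ∀ m ∈ (aug (Finsupp.single e 1)).support,
    (m.degree : ℤ) = deg 0 e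
  homogeneous_d : ∀ i e e', ∀ m ∈ (d i (Finsupp.single e 1) e').support,
    (m.degree : ℤ) + deg i e' = deg (i + 1) e

/-- A graded free resolution is minimal if `d(F_{i+1}) ⊆ 𝔪 F_i` for all `i`, where
`𝔪 = (x_1, …, x_n)`; equivalently, all entries of the matrices of the differentials lie in `𝔪`. -/
def GradedFreeResolution.IsMinimal {I : Ideal (MvPolynomial (Fin n) K)}
    (F : GradedFreeResolution I) : Prop :=
  ∀ i e e', F.d i (Finsupp.single e 1) e' ∈ MvPolynomial.idealOfVars (Fin n) K

/-- The Castelnuovo-Mumford regularity of a homogeneous ideal `I`: the supremum of the numbers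
`a - i`, where `a` runs through the degrees of the basis elements of the `i`-th module of the
minimal graded free resolution of `I`. The minimal graded free resolution is unique up to
isomorphism, so that the outer infimum is over copies of one and the same value.
The regularity of the zero ideal is `-∞`. -/
noncomputable def regularity (I : Ideal (MvPolynomial (Fin n) K)) : EReal :=
  ⨅ (F : GradedFreeResolution I) (_ : F.IsMinimal), ⨆ (i : ℕ) (e : F.ι i),
    (((F.deg i e - (i : ℤ) : ℤ) : ℝ) : EReal)

/-- `I` has a linear resolution: for some `j`, the `i`-th module of the minimal graded free
resolution of `I` is generated in degree `j + i`, for every `i`. -/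
def HasLinearResolution (I : Ideal (MvPolynomial (Fin n) K)) : Prop :=
  ∃ (j : ℤ) (F : GradedFreeResolution I), F.IsMinimal ∧ ∀ i e, F.deg i e = j + (i : ℤ)

/-- `I_⟨j⟩`, the ideal generated by the homogeneous polynomials of degree `j` in `I`. -/
noncomputable def degreeComponentIdeal (I : Ideal (MvPolynomial (Fin n) K)) (j : ℕ) :
    Ideal (MvPolynomial (Fin n) K) :=
  Ideal.span {f | f ∈ I ∧ f.IsHomogeneous j}

/-- An ideal `I` is componentwise linear if it is homogeneous (it contains the homogeneous
components of its elements) and all ideals `I_⟨j⟩` have a linear resolution. -/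
def IsComponentwiseLinear (I : Ideal (MvPolynomial (Fin n) K)) : Prop :=
  (∀ f ∈ I, ∀ j : ℕ, MvPolynomial.homogeneousComponent j f ∈ I) ∧
    ∀ j : ℕ, HasLinearResolution (degreeComponentIdeal I j)

end Resolutions

/-! Everything rests on one exchange property of exponent sets, `IsBalanced`: a unit may be moved
from a larger coordinate to a smaller one. For d ≤ n, `symbolicPower_squarefreeVeronese` shows that
x^a lies in I^(k) exactly when a sums to at least k over every set of n - d + 1 coordinates, and
`squarefreeVeronese_pow` shows that I^k is generated by the exponents of degree dk with entries at
most k. Both sets are balanced. For d > n the ideal I is zero.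

The ideal of a balanced set has linear quotients when its generators are sorted by degree, then by
sum of squares, then by reversed lexicographic order. Given u earlier than v,
`IsBalanced.exists_move` moves a unit of v into a coordinate i with v i < u i so that the result
comes before v. Hence x_i x^v is divisible by an earlier generator, and `monomialIdeal_colon`
concludes.

Since degrees do not decrease along the order, iterated mapping cones (`exists_cone`) are minimal
and the i-th module has degrees (degree of a generator) + i. For the degree slices of a balanced
set, again balanced, this is componentwise linearity. For the set itself it makes the regularity the
largest degree of a generator, which is dk for both kinds of powers. -/

open MvPolynomial

/-! ### Balanced sets of exponent vectors -/

section Balanced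

variable {n : ℕ}

/-- A set of exponent vectors is balanced if it is stable under moving a unit from a coordinate
to a strictly smaller one. -/
def IsBalanced (G : Set (Fin n →₀ ℕ)) : Prop :=
  ∀ (b : Fin n →₀ ℕ) (i j : Fin n), b i ≤ b j →
    b + Finsupp.single j 1 ∈ G → b + Finsupp.single i 1 ∈ G

/-- The sum of the squares of the coordinates. -/
def sumSq (a : Fin n →₀ ℕ) : ℕ := ∑ k, a k ^ 2

theorem sumSq_add_single (b : Fin n →₀ ℕ) (i : Fin n) :
    sumSq (b + Finsupp.single i 1) = sumSq b + (2 * b i + 1) := by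
  have h : ∀ k, (b + Finsupp.single i 1 : Fin n →₀ ℕ) k ^ 2 =
      b k ^ 2 + if k = i then 2 * b i + 1 else 0 := by
    intro k
    by_cases hk : k = i
    · subst hk
      simp
      ring
    · simp [hk]
  simp only [sumSq, h, Finset.sum_add_distrib, Finset.sum_ite_eq', Finset.mem_univ, if_true]

theorem exists_eq_add_single {a : Fin n →₀ ℕ} {i : Fin n} (h : 0 < a i) :
    ∃ b : Fin n →₀ ℕ, a = b + Finsupp.single i 1 := by
  refine ⟨a - Finsupp.single i 1, (tsub_add_cancel_of_le ?_).symm⟩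
  rw [Finsupp.single_le_iff]
  exact h

theorem degree_add_single (b : Fin n →₀ ℕ) (i : Fin n) :
    (b + Finsupp.single i 1).degree = b.degree + 1 := by
  simp

theorem degree_eq_sum_univ (a : Fin n →₀ ℕ) : a.degree = ∑ k, a k :=
  Finsupp.degree_eq_sum a

/-- If some coordinate of `u` exceeds that of `v` but the degree does not, some other coordinate
is smaller. -/
theorem exists_lt_of_degree_le {u v : Fin n →₀ ℕ} (h : u.degree ≤ v.degree) {i : Fin n}
    (hi : v i < u i) : ∃ j, u j < v j := by
  by_contra! hc
  rw [degree_eq_sum_univ, degree_eq_sum_univ] at h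
  exact absurd h (not_le.mpr (Finset.sum_lt_sum (fun k _ => hc k) ⟨i, Finset.mem_univ i, hi⟩))

theorem degree_lt_degree_of_lt {u v : Fin n →₀ ℕ} (h : u < v) : u.degree < v.degree := by
  rw [degree_eq_sum_univ, degree_eq_sum_univ]
  obtain ⟨hle, i, hi⟩ := Finsupp.lt_def.mp h
  exact Finset.sum_lt_sum (fun k _ => hle k) ⟨i, Finset.mem_univ i, hi⟩

/-- Unit moves carry u towards v, from i with u i > v i to j with u j < v j. The bound v j ≤ v i + 1
gives u j < u i, so each move stays in G and does not increase the sum of squares. The induction is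
on the total excess of u over v; at excess 0, minimality of v forces u = v. -/
theorem IsBalanced.sumSq_le_of_minimal {G : Set (Fin n →₀ ℕ)} (hG : IsBalanced G)
    {v : Fin n →₀ ℕ} (hv : Minimal (· ∈ G) v) :
    ∀ (e : ℕ) (u : Fin n →₀ ℕ), ∑ k, (u k - v k) = e → u ∈ G →
      (∀ i j, v i < u i → v j ≤ v i + 1) → u.degree ≤ v.degree →
      sumSq v ≤ sumSq u ∧ u.degree = v.degree := by
  intro e
  induction e with
  | zero =>
    intro u he hu _ _
    have hle : u ≤ v := fun k => by
      have := (Finset.sum_eq_zero_iff.mp he) k (Finset.mem_univ k)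
      omega
    obtain rfl : u = v := le_antisymm hle (hv.2 hu hle)
    exact ⟨le_rfl, rfl⟩
  | succ e ih =>
    intro u he hu hP hdeg
    obtain ⟨i, -, hi⟩ : ∃ i ∈ Finset.univ, u i - v i ≠ 0 := by
      apply Finset.exists_ne_zero_of_sum_ne_zero
      omega
    have hi' : v i < u i := by omega
    obtain ⟨j, hj⟩ := exists_lt_of_degree_le hdeg hi'
    have hij : i ≠ j := by rintro rfl; omega
    have hvj := hP i j hi'
    obtain ⟨b, rfl⟩ := exists_eq_add_single (show 0 < u i by omega)
    simp only [Finsupp.add_apply, Finsupp.single_eq_same,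
      Finsupp.single_eq_of_ne hij.symm] at hi' hj hi
    have hle : b j ≤ b i := by omega
    have hmem := hG b j i hle hu
    -- Only the excess at `i` changes, since coordinate `j` remains at most `v j` after the move.
    have key : ∀ k, (b + Finsupp.single j 1 : Fin n →₀ ℕ) k - v k + (if k = i then 1 else 0) =
        (b + Finsupp.single i 1 : Fin n →₀ ℕ) k - v k := by
      intro k
      by_cases hki : k = i
      · subst hki
        simp [Finsupp.single_eq_of_ne hij]
        omega
      · by_cases hkj : k = j
        · subst hkj
          simp [hki]
          omega
        · simp [hki, hkj]
    have hsum := Finset.sum_congr (rfl : (Finset.univ : Finset (Fin n)) = Finset.univ)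
      (fun k _ => key k)
    rw [he, Finset.sum_add_distrib, Finset.sum_ite_eq' Finset.univ i] at hsum
    simp only [Finset.mem_univ, if_true] at hsum
    have := ih (b + Finsupp.single j 1) (by omega) hmem (by
      intro k l hk
      apply hP k l
      have := key k
      omega) (by simpa using hdeg)
    rw [sumSq_add_single] at this ⊢
    rw [degree_add_single] at this ⊢
    omega

/-- The linear order used for the generators: by degree, then by the sum of squares, then by
the reverse of the lexicographic order. -/
noncomputable def balancedKey (a : Fin n →₀ ℕ) : ℕ ×ₗ ℕ ×ₗ Lex (Fin n → ℕᵒᵈ) :=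
  toLex (a.degree, toLex (sumSq a, toLex fun k => OrderDual.toDual (a k)))

theorem balancedKey_injective : Function.Injective (balancedKey (n := n)) := by
  intro a b h
  have h2 := congrArg (fun p => (ofLex (ofLex p).2).2) h
  ext k
  exact congrFun (congrArg ofLex h2) k

theorem balancedKey_lt_iff {a b : Fin n →₀ ℕ} : balancedKey a < balancedKey b ↔
    a.degree < b.degree ∨ a.degree = b.degree ∧ (sumSq a < sumSq b ∨ sumSq a = sumSq b ∧
      ∃ i, (∀ j < i, a j = b j) ∧ b i < a i) := by
  unfold balancedKey
  rw [Prod.Lex.toLex_lt_toLex, Prod.Lex.toLex_lt_toLex]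
  rfl

theorem IsBalanced.exists_move {G : Set (Fin n →₀ ℕ)} (hG : IsBalanced G)
    {u v : Fin n →₀ ℕ} (hu : u ∈ G) (hv : Minimal (· ∈ G) v)
    (hlt : balancedKey u < balancedKey v) :
    ∃ (b : Fin n →₀ ℕ) (i j : Fin n), v = b + Finsupp.single j 1 ∧ i ≠ j ∧ v i < u i ∧
      b + Finsupp.single i 1 ∈ G ∧ balancedKey (b + Finsupp.single i 1) < balancedKey v := by
  -- A gap of two makes the sum of squares drop. Without such a gap, `sumSq_le_of_minimal` leaves
  -- only the lexicographic tie-break.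
  by_cases hc : ∃ i j, v i < u i ∧ v i + 2 ≤ v j
  · obtain ⟨i, j, hi, hj⟩ := hc
    have hij : i ≠ j := by rintro rfl; omega
    obtain ⟨b, rfl⟩ := exists_eq_add_single (show 0 < v j by omega)
    have hbi : b i + 1 ≤ b j := by
      simp [Finsupp.single_eq_of_ne hij] at hj
      omega
    refine ⟨b, i, j, rfl, hij, hi, hG b i j (by omega) hv.1, ?_⟩
    rw [balancedKey_lt_iff, degree_add_single, degree_add_single, sumSq_add_single,
      sumSq_add_single]
    right
    exact ⟨rfl, Or.inl (by omega)⟩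
  · push Not at hc
    have hP : ∀ i j, v i < u i → v j ≤ v i + 1 := fun i j h => by
      have := hc i j h
      omega
    rw [balancedKey_lt_iff] at hlt
    have hdle : u.degree ≤ v.degree := by omega
    obtain ⟨hsq, hdeg⟩ := hG.sumSq_le_of_minimal hv _ u rfl hu hP hdle
    obtain h | ⟨-, h | ⟨hsq', i, hlow, hi⟩⟩ := hlt
    · omega
    · omega
    obtain ⟨j, hj⟩ := exists_lt_of_degree_le hdle hi
    have hij : i < j := by
      rcases lt_trichotomy i j with h | h | h
      · exact h
      · subst h; omega
      · have := hlow j h; omega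
    have hvj := hP i j hi
    -- Otherwise a move from i to j would bring the sum of squares of u strictly below that of v,
    -- against `sumSq_le_of_minimal`.
    have hstep : u i ≤ u j + 1 := by
      obtain ⟨c, rfl⟩ := exists_eq_add_single (show 0 < u i by omega)
      simp only [Finsupp.add_apply, Finsupp.single_eq_same,
        Finsupp.single_eq_of_ne hij.ne'] at hi hj ⊢
      have hmem := hG c j i (by omega) hu
      have := hG.sumSq_le_of_minimal hv _ _ rfl hmem (by
        intro k l hk
        by_cases hkj : k = j
        · subst hkj
          simp at hk
          omega
        · apply hP k l
          simp [Finsupp.single_eq_of_ne hkj] at hk ⊢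
          omega) (by simpa using hdle)
      rw [sumSq_add_single] at this hsq'
      omega
    obtain ⟨b, rfl⟩ := exists_eq_add_single (show 0 < v j by omega)
    simp only [Finsupp.add_apply, Finsupp.single_eq_same,
      Finsupp.single_eq_of_ne hij.ne] at hi hj hvj
    -- The chain v j ≤ v i + 1 ≤ u i ≤ u j + 1 ≤ v j collapses. The move thus swaps two entries
    -- differing by one: the sum of squares is unchanged, and the entry at i < j grows.
    have hb : b i = b j := by omega
    refine ⟨b, i, j, rfl, hij.ne, by simpa [Finsupp.single_eq_of_ne hij.ne] using hi,
      hG b i j hb.le hv.1, ?_⟩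
    rw [balancedKey_lt_iff, degree_add_single, degree_add_single, sumSq_add_single,
      sumSq_add_single, hb]
    refine Or.inr ⟨rfl, Or.inr ⟨rfl, i, fun k hk => ?_, ?_⟩⟩
    · simp [Finsupp.single_eq_of_ne hk.ne, Finsupp.single_eq_of_ne (hk.trans hij).ne]
    · simp [Finsupp.single_eq_of_ne hij.ne]

theorem exists_minimal_le {G : Set (Fin n →₀ ℕ)} {a : Fin n →₀ ℕ} (ha : a ∈ G) :
    ∃ b ≤ a, Minimal (· ∈ G) b :=
  (Set.isPWO_of_wellQuasiOrderedLE G).exists_le_minimal ha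

theorem finite_setOf_minimal (G : Set (Fin n →₀ ℕ)) : {a | Minimal (· ∈ G) a}.Finite :=
  (setOfPred_minimal_antichain _).finite_of_partiallyWellOrderedOn
    (Set.isPWO_of_wellQuasiOrderedLE _)

/-- Passing to a minimal element below the moved vector keeps the key small, because degree is
compared first. -/
theorem IsBalanced.exists_minimal_le_add_single {G : Set (Fin n →₀ ℕ)} (hG : IsBalanced G)
    {u v : Fin n →₀ ℕ} (hu : u ∈ G) (hv : Minimal (· ∈ G) v)
    (hlt : balancedKey u < balancedKey v) :
    ∃ i, v i < u i ∧ ∃ w, Minimal (· ∈ G) w ∧ balancedKey w < balancedKey v ∧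
      w ≤ v + Finsupp.single i 1 := by
  obtain ⟨b, i, j, rfl, hij, hi, hmem, hkey⟩ := hG.exists_move hu hv hlt
  obtain ⟨w, hw, hwmin⟩ := exists_minimal_le hmem
  refine ⟨i, hi, w, hwmin, ?_, hw.trans ?_⟩
  · rcases hw.eq_or_lt with rfl | hlt'
    · exact hkey
    · have := degree_lt_degree_of_lt hlt'
      rw [balancedKey_lt_iff, degree_add_single]
      rw [degree_add_single] at this
      exact Or.inl this
  · intro k
    simp

/-- The minimal elements of a set of exponent vectors can be listed in increasing order. -/
theorem exists_sorted_minimal (G : Set (Fin n →₀ ℕ)) :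
    ∃ (m : ℕ) (u : Fin m → (Fin n →₀ ℕ)), StrictMono (balancedKey ∘ u) ∧
      Set.range u = {a | Minimal (· ∈ G) a} := by
  classical
  let s : Finset (ℕ ×ₗ ℕ ×ₗ Lex (Fin n → ℕᵒᵈ)) :=
    (finite_setOf_minimal G).toFinset.image balancedKey
  have hs : ∀ i, ∃ a, Minimal (· ∈ G) a ∧ balancedKey a = s.orderEmbOfFin rfl i := by
    intro i
    have := s.orderEmbOfFin_mem rfl i
    obtain ⟨a, ha, h⟩ := Finset.mem_image.mp this
    exact ⟨a, by simpa using ha, h⟩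
  choose u hu hkey using hs
  refine ⟨s.card, u, ?_, ?_⟩
  · intro i j hij
    simp only [Function.comp, hkey]
    exact (s.orderEmbOfFin rfl).strictMono hij
  · ext a
    constructor
    · rintro ⟨i, rfl⟩
      exact hu i
    · intro ha
      have hmem : balancedKey a ∈ Set.range (s.orderEmbOfFin rfl) := by
        rw [Finset.range_orderEmbOfFin]
        exact Finset.mem_image_of_mem _ (by simpa using ha)
      obtain ⟨i, hi⟩ := hmem
      exact ⟨i, balancedKey_injective ((hkey i).trans hi)⟩

/-- If c ∈ B is below b + e_j but not below b, then c j = b j + 1, and the unit can be moved inside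
c because c i ≤ b i ≤ b j. -/
theorem IsBalanced.upperClosure {B : Set (Fin n →₀ ℕ)} (hB : IsBalanced B) :
    IsBalanced (upperClosure B : Set (Fin n →₀ ℕ)) := by
  rintro b i j hij ⟨c, hc, hle⟩
  by_cases h : c ≤ b
  · exact ⟨c, hc, h.trans le_self_add⟩
  have hcj : c j = b j + 1 := by
    by_contra hne
    apply h
    intro k
    have hk := hle k
    by_cases hkj : k = j
    · subst hkj
      simp at hk
      omega
    · simpa [Finsupp.single_eq_of_ne hkj] using hk
  obtain ⟨c, rfl⟩ := exists_eq_add_single (show 0 < c j by omega)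
  have hle' : c ≤ b := by simpa using hle
  refine ⟨c + Finsupp.single i 1, hB c i j ?_ hc, by simpa using hle'⟩
  have := hle' i
  simp at hcj
  omega

end Balanced

/-! ### Monomial ideals -/

section MonomialIdeal

variable {K : Type*} [Field K] {n : ℕ}

variable (K) in
/-- The ideal generated by the monomials with exponent vectors in `G`. -/
noncomputable def monomialIdeal (G : Set (Fin n →₀ ℕ)) : Ideal (MvPolynomial (Fin n) K) :=
  Ideal.span ((fun a => monomial a (1 : K)) '' G)

theorem mem_monomialIdeal {G : Set (Fin n →₀ ℕ)} {f : MvPolynomial (Fin n) K} :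
    f ∈ monomialIdeal K G ↔ ∀ a ∈ f.support, ∃ b ∈ G, b ≤ a :=
  mem_ideal_span_monomial_image

theorem mem_monomialIdeal_of_isUpperSet {G : Set (Fin n →₀ ℕ)} (hG : IsUpperSet G)
    {f : MvPolynomial (Fin n) K} : f ∈ monomialIdeal K G ↔ ∀ a ∈ f.support, a ∈ G := by
  rw [mem_monomialIdeal]
  exact forall₂_congr fun a _ => ⟨fun ⟨b, hb, h⟩ => hG h hb, fun h => ⟨a, h, le_rfl⟩⟩

theorem monomial_mem_monomialIdeal {G : Set (Fin n →₀ ℕ)} {a : Fin n →₀ ℕ} :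
    monomial a (1 : K) ∈ monomialIdeal K G ↔ ∃ b ∈ G, b ≤ a := by
  classical
  rw [mem_monomialIdeal, support_monomial, if_neg one_ne_zero]
  simp

theorem monomialIdeal_upperClosure (B : Set (Fin n →₀ ℕ)) :
    monomialIdeal K (upperClosure B : Set (Fin n →₀ ℕ)) = monomialIdeal K B := by
  ext f
  rw [mem_monomialIdeal_of_isUpperSet (upperClosure B).upper, mem_monomialIdeal]
  rfl

theorem minimalMonomials_monomialIdeal {G : Set (Fin n →₀ ℕ)} (hG : IsUpperSet G) :
    minimalMonomials (monomialIdeal K G) = {a | Minimal (· ∈ G) a} := by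
  have h : (fun b : Fin n →₀ ℕ => monomial b (1 : K) ∈ monomialIdeal K G) = (· ∈ G) := by
    ext b
    rw [monomial_mem_monomialIdeal]
    exact ⟨fun ⟨c, hc, hle⟩ => hG hle hc, fun hb => ⟨b, hb, le_rfl⟩⟩
  rw [minimalMonomials, h]

theorem monomialIdeal_setOf_minimal (G : Set (Fin n →₀ ℕ)) :
    monomialIdeal K {a | Minimal (· ∈ G) a} = monomialIdeal K G := by
  ext f
  rw [mem_monomialIdeal, mem_monomialIdeal]
  refine forall₂_congr fun a _ => ⟨fun ⟨b, hb, hle⟩ => ⟨b, hb.1, hle⟩, fun ⟨b, hb, hle⟩ => ?_⟩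
  obtain ⟨c, hc, hmin⟩ := exists_minimal_le hb
  exact ⟨c, hmin, hc.trans hle⟩

theorem minimal_upperClosure_subset {B : Set (Fin n →₀ ℕ)} {a : Fin n →₀ ℕ}
    (h : Minimal (· ∈ (upperClosure B : Set (Fin n →₀ ℕ))) a) : a ∈ B := by
  obtain ⟨b, hb, hle⟩ := h.1
  rwa [le_antisymm (h.2 (subset_upperClosure hb) hle) hle]

theorem support_mul_monomial_one (f : MvPolynomial (Fin n) K) (v : Fin n →₀ ℕ) :
    ∀ b, b ∈ (f * monomial v (1 : K)).support ↔ ∃ a ∈ f.support, a + v = b := by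
  intro b
  rw [mem_support_iff, coeff_mul_monomial']
  constructor
  · intro h
    split_ifs at h with hle
    · exact ⟨b - v, by simpa using h, tsub_add_cancel_of_le hle⟩
    · exact absurd rfl h
  · rintro ⟨a, ha, rfl⟩
    rw [if_pos le_add_self]
    simpa using ha

/-- If x^u divides x^a x^v and v i < u i, then a i > 0, so x^a is already a multiple of x_i. -/
theorem monomialIdeal_colon {s : Set (Fin n →₀ ℕ)} {v : Fin n →₀ ℕ}
    (h : ∀ u ∈ s, ∃ i, v i < u i ∧ ∃ w ∈ s, w ≤ v + Finsupp.single i 1) :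
    (monomialIdeal K s).colon {monomial v (1 : K)} =
      Ideal.span (X '' {i | ∃ w ∈ s, w ≤ v + Finsupp.single i 1}) := by
  ext f
  rw [Submodule.mem_colon_singleton, smul_eq_mul, mem_monomialIdeal, mem_ideal_span_X_image]
  simp only [support_mul_monomial_one]
  constructor
  · intro hf a ha
    obtain ⟨u, hu, hle⟩ := hf _ ⟨a, ha, rfl⟩
    obtain ⟨i, hi, hw⟩ := h u hu
    have := hle i
    rw [Finsupp.add_apply] at this
    exact ⟨i, hw, by omega⟩
  · rintro hf _ ⟨a, ha, rfl⟩
    obtain ⟨i, ⟨w, hw, hle⟩, hi⟩ := hf a ha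
    refine ⟨w, hw, hle.trans ?_⟩
    rw [add_comm]
    gcongr
    rw [Finsupp.single_le_iff]
    omega

/-- The monomial ideal of a balanced upper set has linear quotients, with respect to an order of
the generators in which the degrees do not decrease. -/
theorem IsBalanced.exists_linearQuotients {G : Set (Fin n →₀ ℕ)} (hG : IsBalanced G) :
    ∃ (m : ℕ) (u : Fin m → (Fin n →₀ ℕ)),
      Function.Injective u ∧ Set.range u = {a | Minimal (· ∈ G) a} ∧
      (∀ i j, i < j → (u i).degree ≤ (u j).degree) ∧
      ∀ i : Fin m, ∃ A : Set (Fin n),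
        (monomialIdeal K (u '' {j | j < i})).colon {monomial (u i) (1 : K)} =
          Ideal.span (X '' A) := by
  obtain ⟨m, u, hmono, hrange⟩ := exists_sorted_minimal G
  have hmin : ∀ i, Minimal (· ∈ G) (u i) := fun i => hrange.subset ⟨i, rfl⟩
  refine ⟨m, u, fun i j h => hmono.injective (congrArg balancedKey h), hrange, ?_, ?_⟩
  · intro i j hij
    have := balancedKey_lt_iff.mp (hmono hij)
    omega
  · intro i
    refine ⟨_, monomialIdeal_colon ?_⟩
    rintro _ ⟨j, hj, rfl⟩
    obtain ⟨k, hk, w, hw, hlt, hle⟩ :=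
      hG.exists_minimal_le_add_single (hmin j).1 (hmin i) (hmono hj)
    obtain ⟨l, rfl⟩ := hrange.superset hw
    exact ⟨k, hk, u l, ⟨l, hmono.lt_iff_lt.mp hlt, rfl⟩, hle⟩

theorem IsBalanced.hasLinearQuotients {G : Set (Fin n →₀ ℕ)} (hG : IsBalanced G)
    (hup : IsUpperSet G) : HasLinearQuotients (monomialIdeal K G) := by
  obtain ⟨m, u, hinj, hrange, -, hcolon⟩ := hG.exists_linearQuotients (K := K)
  refine ⟨⟨G, rfl⟩, m, u, hinj, by rw [hrange, minimalMonomials_monomialIdeal hup], fun i => ?_⟩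
  obtain ⟨A, hA⟩ := hcolon i
  refine ⟨A, ?_⟩
  rw [← hA, monomialIdeal]
  congr 2
  ext f
  simp [eq_comm]

theorem homogeneousComponent_mem_monomialIdeal {G : Set (Fin n →₀ ℕ)}
    {f : MvPolynomial (Fin n) K} (hf : f ∈ monomialIdeal K G) (j : ℕ) :
    homogeneousComponent j f ∈ monomialIdeal K G := by
  rw [mem_monomialIdeal] at hf ⊢
  intro a ha
  rw [mem_support_iff, coeff_homogeneousComponent] at ha
  exact hf a (mem_support_iff.mpr fun h => ha (by simp [h]))

theorem degreeComponentIdeal_monomialIdeal {G : Set (Fin n →₀ ℕ)} (hG : IsUpperSet G) (j : ℕ) :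
    degreeComponentIdeal (monomialIdeal K G) j = monomialIdeal K {a ∈ G | a.degree = j} := by
  apply le_antisymm
  · refine Ideal.span_le.mpr ?_
    rintro f ⟨hf, hfj⟩
    rw [SetLike.mem_coe, mem_monomialIdeal]
    intro a ha
    refine ⟨a, ⟨(mem_monomialIdeal_of_isUpperSet hG).mp hf a ha, ?_⟩, le_rfl⟩
    have : Finsupp.weight 1 a = j := hfj (mem_support_iff.mp ha)
    rw [Finsupp.degree_eq_weight_one]
    exact this
  · refine Ideal.span_le.mpr ?_
    rintro _ ⟨a, ⟨ha, hj⟩, rfl⟩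
    refine Ideal.subset_span ⟨Ideal.subset_span ⟨a, ha, rfl⟩, isHomogeneous_monomial _ hj⟩

theorem IsBalanced.inter_degree {G : Set (Fin n →₀ ℕ)} (hG : IsBalanced G) (j : ℕ) :
    IsBalanced {a ∈ G | a.degree = j} := by
  rintro b i k hik ⟨hb, hdeg⟩
  exact ⟨hG b i k hik hb, by rwa [degree_add_single] at hdeg ⊢⟩

end MonomialIdeal

/-! ### Graded free modules and resolutions -/

section GradedFree

variable {K : Type*} [Field K] {n : ℕ} {ι ι' κ : Type*}

/-- A vector of the graded free module with basis degrees `δ` is homogeneous of degree `D`. -/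
def IsHomogeneousVector (δ : ι → ℤ) (D : ℤ) (z : ι →₀ MvPolynomial (Fin n) K) : Prop :=
  ∀ e, ∀ m ∈ (z e).support, (m.degree : ℤ) + δ e = D

/-- A linear map of graded free modules is homogeneous of degree zero. -/
def IsHomogeneousMap (δ : ι → ℤ) (δ' : ι' → ℤ)
    (T : (ι →₀ MvPolynomial (Fin n) K) →ₗ[MvPolynomial (Fin n) K]
      (ι' →₀ MvPolynomial (Fin n) K)) : Prop :=
  ∀ e, IsHomogeneousVector δ' (δ e) (T (Finsupp.single e 1))

/-- The homogeneous component of degree `c` of a polynomial, for an integer `c`. -/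
noncomputable def intComponent (c : ℤ) : MvPolynomial (Fin n) K →ₗ[K] MvPolynomial (Fin n) K :=
  weightedHomogeneousComponent (fun _ => (1 : ℤ)) c

theorem coeff_intComponent (c : ℤ) (f : MvPolynomial (Fin n) K) (m : Fin n →₀ ℕ) :
    coeff m (intComponent c f) = if (m.degree : ℤ) = c then coeff m f else 0 := by
  rw [intComponent, coeff_weightedHomogeneousComponent]
  have : Finsupp.weight (fun _ => (1 : ℤ)) m = m.degree := by
    simp [Finsupp.weight_apply, Finsupp.sum, Finsupp.degree_apply]
  rw [this]

/-- The homogeneous component of degree `D` of a vector of a graded free module. -/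
noncomputable def vectorComponent (δ : ι → ℤ) (D : ℤ) :
    (ι →₀ MvPolynomial (Fin n) K) →+ (ι →₀ MvPolynomial (Fin n) K) :=
  Finsupp.liftAddHom fun e =>
    (Finsupp.singleAddHom e).comp (intComponent (D - δ e)).toAddMonoidHom

theorem vectorComponent_single (δ : ι → ℤ) (D : ℤ) (e : ι) (p : MvPolynomial (Fin n) K) :
    vectorComponent δ D (Finsupp.single e p) = Finsupp.single e (intComponent (D - δ e) p) := by
  simp [vectorComponent]

theorem vectorComponent_apply (δ : ι → ℤ) (D : ℤ) (z : ι →₀ MvPolynomial (Fin n) K) (e : ι) :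
    vectorComponent δ D z e = intComponent (D - δ e) (z e) := by
  classical
  induction z using Finsupp.induction_linear with
  | zero => simp
  | add f g hf hg => simp [hf, hg]
  | single a p =>
    rw [vectorComponent_single]
    by_cases h : a = e
    · subst h; simp
    · simp [h]

theorem coeff_vectorComponent (δ : ι → ℤ) (D : ℤ) (z : ι →₀ MvPolynomial (Fin n) K) (e : ι)
    (m : Fin n →₀ ℕ) : coeff m (vectorComponent δ D z e) =
      if (m.degree : ℤ) + δ e = D then coeff m (z e) else 0 := by
  rw [vectorComponent_apply, coeff_intComponent]
  congr 1
  exact propext ⟨fun h => by omega, fun h => by omega⟩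

theorem isHomogeneousVector_iff {δ : ι → ℤ} {D : ℤ} {z : ι →₀ MvPolynomial (Fin n) K} :
    IsHomogeneousVector δ D z ↔ vectorComponent δ D z = z := by
  constructor
  · intro h
    ext e m
    rw [coeff_vectorComponent]
    split_ifs with hd
    · rfl
    · by_contra hne
      exact hd (h e m (mem_support_iff.mpr (Ne.symm hne)))
  · intro h e m hm
    rw [← h, mem_support_iff, coeff_vectorComponent] at hm
    by_contra hd
    exact hm (if_neg hd)

theorem isHomogeneousVector_vectorComponent (δ : ι → ℤ) (D : ℤ)
    (z : ι →₀ MvPolynomial (Fin n) K) : IsHomogeneousVector δ D (vectorComponent δ D z) := by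
  intro e m hm
  rw [mem_support_iff, coeff_vectorComponent] at hm
  by_contra hd
  exact hm (if_neg hd)

theorem IsHomogeneousVector.monomial_smul {δ : ι → ℤ} {D : ℤ}
    {z : ι →₀ MvPolynomial (Fin n) K} (h : IsHomogeneousVector δ D z) (m : Fin n →₀ ℕ) (c : K) :
    IsHomogeneousVector δ (m.degree + D) (monomial m c • z) := by
  intro e b hb
  rw [Finsupp.smul_apply, smul_eq_mul, mem_support_iff, coeff_monomial_mul'] at hb
  split_ifs at hb with hle
  · obtain ⟨a, rfl⟩ := le_iff_exists_add.mp hle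
    rw [add_tsub_cancel_left] at hb
    have := h e a (mem_support_iff.mpr (right_ne_zero_of_mul hb))
    rw [map_add]
    push_cast
    omega
  · exact absurd rfl hb

theorem IsHomogeneousVector.vectorComponent_eq_zero {δ : ι → ℤ} {D E : ℤ}
    {z : ι →₀ MvPolynomial (Fin n) K} (h : IsHomogeneousVector δ D z) (hDE : D ≠ E) :
    vectorComponent δ E z = 0 := by
  ext e m
  rw [coeff_vectorComponent]
  split_ifs with hd
  · by_contra hne
    exact hDE ((h e m (mem_support_iff.mpr hne)).symm.trans hd)
  · simp

theorem IsHomogeneousMap.map_vectorComponent {δ : ι → ℤ} {δ' : ι' → ℤ}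
    {T : (ι →₀ MvPolynomial (Fin n) K) →ₗ[MvPolynomial (Fin n) K]
      (ι' →₀ MvPolynomial (Fin n) K)} (hT : IsHomogeneousMap δ δ' T) (D : ℤ)
    (z : ι →₀ MvPolynomial (Fin n) K) :
    T (vectorComponent δ D z) = vectorComponent δ' D (T z) := by
  induction z using Finsupp.induction_linear with
  | zero => simp
  | add f g hf hg => simp [hf, hg]
  | single e p =>
    induction p using MvPolynomial.induction_on' with
    | add p q hp hq => simp only [Finsupp.single_add, map_add, hp, hq]
    | monomial m c =>
      have hsm : Finsupp.single e (monomial m c) = monomial m c • Finsupp.single e 1 := by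
        simp
      have h1 : IsHomogeneousVector δ (δ e)
          (Finsupp.single e (1 : MvPolynomial (Fin n) K)) := by
        classical
        intro a b hb
        by_cases hae : a = e
        · subst hae
          rw [Finsupp.single_eq_same, mem_support_iff, coeff_one] at hb
          have : 0 = b := by
            by_contra hne
            exact hb (if_neg hne)
          subst this
          simp
        · simp [Finsupp.single_eq_of_ne hae] at hb
      have h2 := h1.monomial_smul m c
      have h3 := (hT e).monomial_smul m c
      rw [← T.map_smul] at h3
      rw [hsm]
      by_cases hD : (m.degree : ℤ) + δ e = D
      · rw [hD, isHomogeneousVector_iff] at h2 h3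
        rw [h2, h3]
      · rw [h2.vectorComponent_eq_zero hD, h3.vectorComponent_eq_zero hD, map_zero]

theorem IsHomogeneousMap.map_vector {δ : ι → ℤ} {δ' : ι' → ℤ}
    {T : (ι →₀ MvPolynomial (Fin n) K) →ₗ[MvPolynomial (Fin n) K]
      (ι' →₀ MvPolynomial (Fin n) K)} (hT : IsHomogeneousMap δ δ' T) {D : ℤ}
    {z : ι →₀ MvPolynomial (Fin n) K} (hz : IsHomogeneousVector δ D z) :
    IsHomogeneousVector δ' D (T z) := by
  rw [isHomogeneousVector_iff] at hz ⊢
  rw [← hT.map_vectorComponent, hz]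

/-- A homogeneous map into the range of a homogeneous map lifts to a homogeneous map. -/
theorem IsHomogeneousMap.exists_lift {δ : ι → ℤ} {δ' : ι' → ℤ} {ε : κ → ℤ}
    {T : (ι →₀ MvPolynomial (Fin n) K) →ₗ[MvPolynomial (Fin n) K]
      (ι' →₀ MvPolynomial (Fin n) K)} (hT : IsHomogeneousMap δ δ' T)
    {ψ : (κ →₀ MvPolynomial (Fin n) K) →ₗ[MvPolynomial (Fin n) K]
      (ι' →₀ MvPolynomial (Fin n) K)} (hψ : IsHomogeneousMap ε δ' ψ)
    (h : ∀ z, ψ z ∈ LinearMap.range T) :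
    ∃ φ : (κ →₀ MvPolynomial (Fin n) K) →ₗ[MvPolynomial (Fin n) K]
      (ι →₀ MvPolynomial (Fin n) K), IsHomogeneousMap ε δ φ ∧ T ∘ₗ φ = ψ := by
  choose z hz using fun e => h (Finsupp.single e 1)
  -- An arbitrary preimage of a basis element is cut down to its component of the right degree; `T`
  -- commutes with taking components.
  refine ⟨Finsupp.linearCombination _ fun e => vectorComponent δ (ε e) (z e), ?_, ?_⟩
  · intro e
    rw [Finsupp.linearCombination_single, one_smul]
    exact isHomogeneousVector_vectorComponent _ _ _
  · apply Finsupp.lhom_ext'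
    intro e
    apply LinearMap.ext_ring
    simp only [LinearMap.comp_apply, Finsupp.lsingle_apply, Finsupp.linearCombination_single,
      one_smul]
    rw [hT.map_vectorComponent, hz, isHomogeneousVector_iff.mp (hψ e)]

theorem IsHomogeneousMap.comp {ι'' : Type*} {δ : ι → ℤ} {δ' : ι' → ℤ} {δ'' : ι'' → ℤ}
    {T' : (ι' →₀ MvPolynomial (Fin n) K) →ₗ[MvPolynomial (Fin n) K]
      (ι'' →₀ MvPolynomial (Fin n) K)}
    {T : (ι →₀ MvPolynomial (Fin n) K) →ₗ[MvPolynomial (Fin n) K]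
      (ι' →₀ MvPolynomial (Fin n) K)}
    (hT' : IsHomogeneousMap δ' δ'' T') (hT : IsHomogeneousMap δ δ' T) :
    IsHomogeneousMap δ δ'' (T' ∘ₗ T) := fun e => hT'.map_vector (hT e)

theorem IsHomogeneousMap.add_const {δ : ι → ℤ} {δ' : ι' → ℤ}
    {T : (ι →₀ MvPolynomial (Fin n) K) →ₗ[MvPolynomial (Fin n) K]
      (ι' →₀ MvPolynomial (Fin n) K)} (hT : IsHomogeneousMap δ δ' T) (c : ℤ) :
    IsHomogeneousMap (fun e => δ e + c) (fun e => δ' e + c) T := fun e e' m hm => by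
  have := hT e e' m hm
  beta_reduce
  omega

theorem mem_idealOfVars_of_degree_pos {f : MvPolynomial (Fin n) K}
    (h : ∀ m ∈ f.support, 0 < m.degree) : f ∈ idealOfVars (Fin n) K := by
  rw [← pow_one (idealOfVars (Fin n) K), mem_pow_idealOfVars_iff]
  exact h

end GradedFree

namespace GradedFreeResolution

variable {K : Type*} [Field K] {n : ℕ} {J Q : Ideal (MvPolynomial (Fin n) K)}

/-- The bases of the resolution of `S / J` given by a resolution of `J`. -/
@[reducible] def augι (F : GradedFreeResolution J) : ℕ → Type
  | 0 => Unit
  | i + 1 => F.ι i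

/-- The degrees of the bases of the resolution of `S / J`. -/
def augDeg (F : GradedFreeResolution J) : ∀ i, F.augι i → ℤ
  | 0 => fun _ => 0
  | i + 1 => F.deg i

/-- The differentials of the resolution of `S / J`. -/
noncomputable def augD (F : GradedFreeResolution J) :
    ∀ i, (F.augι (i + 1) →₀ MvPolynomial (Fin n) K) →ₗ[MvPolynomial (Fin n) K]
      (F.augι i →₀ MvPolynomial (Fin n) K)
  | 0 => (Finsupp.lsingle () : MvPolynomial (Fin n) K →ₗ[MvPolynomial (Fin n) K]
      (Unit →₀ MvPolynomial (Fin n) K)) ∘ₗ F.aug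
  | i + 1 => F.d i

theorem finite_augι (F : GradedFreeResolution J) : ∀ i, Finite (F.augι i)
  | 0 => inferInstanceAs (Finite Unit)
  | i + 1 => F.finite_basis i

theorem exact_augD (F : GradedFreeResolution J) : ∀ i, Function.Exact (F.augD (i + 1)) (F.augD i)
  | 0 => fun z => Finsupp.single_eq_zero.trans (F.exact_zero z)
  | i + 1 => F.exact_succ i

theorem isHomogeneousMap_augD (F : GradedFreeResolution J) :
    ∀ i, IsHomogeneousMap (F.augDeg (i + 1)) (F.augDeg i) (F.augD i)
  | 0 => fun e _ m hm => by
    change m ∈ (Finsupp.single () (F.aug (Finsupp.single e 1)) () :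
      MvPolynomial (Fin n) K).support at hm
    rw [Finsupp.single_eq_same] at hm
    exact (add_zero _).trans (F.homogeneous_aug e m hm)
  | i + 1 => fun e e' m hm => F.homogeneous_d i e e' m hm

/-- Multiplication by `u` with `u * Q ⊆ J` lifts to a homogeneous map of resolutions from that of
`S / Q` to that of `S / J`. -/
theorem exists_chainMap (F : GradedFreeResolution J) (G : GradedFreeResolution Q)
    {u : MvPolynomial (Fin n) K} {D : ℤ} (hu : ∀ m ∈ u.support, (m.degree : ℤ) = D)
    (hQ : ∀ q ∈ Q, q * u ∈ J) :
    ∃ ψ : ∀ i, (G.augι i →₀ MvPolynomial (Fin n) K) →ₗ[MvPolynomial (Fin n) K]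
        (F.augι i →₀ MvPolynomial (Fin n) K),
      (∀ b : Unit →₀ MvPolynomial (Fin n) K, ψ 0 b = u • b) ∧
      (∀ i, F.augD i ∘ₗ ψ (i + 1) = ψ i ∘ₗ G.augD i) ∧
      ∀ i, IsHomogeneousMap (fun e => G.augDeg i e + D) (F.augDeg i) (ψ i) := by
  -- The range condition is carried through the recursion because it is what permits the next lift.
  let P : ∀ i, ((G.augι i →₀ MvPolynomial (Fin n) K) →ₗ[MvPolynomial (Fin n) K]
        (F.augι i →₀ MvPolynomial (Fin n) K)) → Prop := fun i ψ =>
    IsHomogeneousMap (fun e => G.augDeg i e + D) (F.augDeg i) ψ ∧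
      ∀ z, ψ (G.augD i z) ∈ LinearMap.range (F.augD i)
  have step : ∀ i (ψ : {ψ // P i ψ}), ∃ φ : {φ // P (i + 1) φ},
      F.augD i ∘ₗ φ.1 = ψ.1 ∘ₗ G.augD i := by
    rintro i ⟨ψ, hψ, hr⟩
    obtain ⟨φ, hφ, hcomm⟩ := (F.isHomogeneousMap_augD i).exists_lift
      (hψ.comp ((G.isHomogeneousMap_augD i).add_const D)) hr
    refine ⟨⟨φ, hφ, fun z => (F.exact_augD i _).mp ?_⟩, hcomm⟩
    have := LinearMap.congr_fun hcomm (G.augD (i + 1) z)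
    simp only [LinearMap.comp_apply] at this
    rw [this, (G.exact_augD i).apply_apply_eq_zero, map_zero]
  choose next hnext using step
  let base : {ψ // P 0 ψ} := ⟨u • (LinearMap.id : (Unit →₀ MvPolynomial (Fin n) K)
      →ₗ[MvPolynomial (Fin n) K] (Unit →₀ MvPolynomial (Fin n) K)), by
    constructor
    · intro e e' m hm
      have hm' : m ∈ u.support := by
        change m ∈ (u • (Finsupp.single () 1 : Unit →₀ MvPolynomial (Fin n) K) ()).support at hm
        simpa using hm
      have := hu m hm'
      change (m.degree : ℤ) + 0 = 0 + D
      omega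
    · intro z
      have hz : G.aug z ∈ Q := by
        have := LinearMap.mem_range_self G.aug z
        rwa [G.range_aug] at this
      have := hQ _ hz
      rw [← F.range_aug] at this
      obtain ⟨w, hw⟩ := this
      refine ⟨w, ?_⟩
      change (Finsupp.single () (F.aug w) : Unit →₀ MvPolynomial (Fin n) K) =
        u • (Finsupp.single () (G.aug z) : Unit →₀ MvPolynomial (Fin n) K)
      rw [hw, Finsupp.smul_single, smul_eq_mul, mul_comm]⟩
  let ψ : ∀ i, {ψ // P i ψ} := fun i => Nat.rec base (fun i ψ => next i ψ) i
  exact ⟨fun i => (ψ i).1, fun b => rfl, fun i => hnext i (ψ i), fun i => (ψ i).2.1⟩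

end GradedFreeResolution

/-! ### The mapping cone -/

section Cone

variable {R A₂ A₁ A₀ B₂ B₁ B₀ : Type*} [CommRing R] [AddCommGroup A₂] [AddCommGroup A₁]
  [AddCommGroup A₀] [AddCommGroup B₂] [AddCommGroup B₁] [AddCommGroup B₀] [Module R A₂]
  [Module R A₁] [Module R A₀] [Module R B₂] [Module R B₁] [Module R B₀]

/-- The diagram chase shared by all places of the cone: adding ψ' c to a gives a cycle for `dA`. -/
theorem cone_exists_preimage {dA' : A₂ →ₗ[R] A₁} {dA : A₁ →ₗ[R] A₀} {dB' : B₂ →ₗ[R] B₁}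
    {ψ' : B₂ →ₗ[R] A₁} {ψ : B₁ →ₗ[R] A₀} (hA : Function.Exact dA' dA)
    (hψ : dA ∘ₗ ψ' = ψ ∘ₗ dB') {a : A₁} {b : B₁} (h : dA a + ψ b = 0)
    (hb : b ∈ Set.range dB') :
    ∃ (a' : A₂) (b' : B₂), dA' a' + ψ' b' = a ∧ -dB' b' = b := by
  obtain ⟨c, rfl⟩ := hb
  have hc : dA (a + ψ' c) = 0 := by
    rw [map_add, ← h, ← LinearMap.comp_apply, hψ, LinearMap.comp_apply]
  obtain ⟨a', ha'⟩ := (hA _).mp hc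
  exact ⟨a', -c, by rw [ha', map_neg, add_neg_cancel_right], by rw [map_neg, neg_neg]⟩

variable {ι₁ ι₀ κ₁ κ₀ : Type*}

/-- The differential of a mapping cone of complexes of free modules. -/
noncomputable def coneD (dA : (ι₁ →₀ R) →ₗ[R] (ι₀ →₀ R)) (dB : (κ₁ →₀ R) →ₗ[R] (κ₀ →₀ R))
    (ψ : (κ₁ →₀ R) →ₗ[R] (ι₀ →₀ R)) : (ι₁ ⊕ κ₁ →₀ R) →ₗ[R] (ι₀ ⊕ κ₀ →₀ R) :=
  (Finsupp.sumFinsuppLEquivProdFinsupp R).symm.toLinearMap ∘ₗ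
    ((dA.coprod ψ).prod (-dB ∘ₗ LinearMap.snd R _ _)) ∘ₗ
    (Finsupp.sumFinsuppLEquivProdFinsupp R).toLinearMap

/-- The last map of a mapping cone, with values in `R`. -/
noncomputable def coneAug (dA : (ι₁ →₀ R) →ₗ[R] R) (ψ : (κ₁ →₀ R) →ₗ[R] R) :
    (ι₁ ⊕ κ₁ →₀ R) →ₗ[R] R :=
  dA.coprod ψ ∘ₗ (Finsupp.sumFinsuppLEquivProdFinsupp R).toLinearMap

variable (dA : (ι₁ →₀ R) →ₗ[R] (ι₀ →₀ R)) (dB : (κ₁ →₀ R) →ₗ[R] (κ₀ →₀ R))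
    (ψ : (κ₁ →₀ R) →ₗ[R] (ι₀ →₀ R))

theorem sumFinsuppLEquivProdFinsupp_single_inl (e : ι₁) (r : R) :
    Finsupp.sumFinsuppLEquivProdFinsupp R (Finsupp.single (Sum.inl e : ι₁ ⊕ κ₁) r) =
      (Finsupp.single e r, 0) := by
  classical
  ext x <;> simp [Finsupp.single_apply]

theorem sumFinsuppLEquivProdFinsupp_single_inr (e : κ₁) (r : R) :
    Finsupp.sumFinsuppLEquivProdFinsupp R (Finsupp.single (Sum.inr e : ι₁ ⊕ κ₁) r) =
      (0, Finsupp.single e r) := by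
  classical
  ext x <;> simp [Finsupp.single_apply]

theorem coneD_inl_inl (e : ι₁) (e' : ι₀) :
    coneD dA dB ψ (Finsupp.single (Sum.inl e) 1) (Sum.inl e') = dA (Finsupp.single e 1) e' := by
  simp [coneD, sumFinsuppLEquivProdFinsupp_single_inl, -Finsupp.sumFinsuppLEquivProdFinsupp_apply]

theorem coneD_inl_inr (e : ι₁) (e' : κ₀) :
    coneD dA dB ψ (Finsupp.single (Sum.inl e) 1) (Sum.inr e') = 0 := by
  simp [coneD, sumFinsuppLEquivProdFinsupp_single_inl, -Finsupp.sumFinsuppLEquivProdFinsupp_apply]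

theorem coneD_inr_inl (e : κ₁) (e' : ι₀) :
    coneD dA dB ψ (Finsupp.single (Sum.inr e) 1) (Sum.inl e') = ψ (Finsupp.single e 1) e' := by
  simp [coneD, sumFinsuppLEquivProdFinsupp_single_inr, -Finsupp.sumFinsuppLEquivProdFinsupp_apply]

theorem coneD_inr_inr (e : κ₁) (e' : κ₀) :
    coneD dA dB ψ (Finsupp.single (Sum.inr e) 1) (Sum.inr e') = -dB (Finsupp.single e 1) e' := by
  simp [coneD, sumFinsuppLEquivProdFinsupp_single_inr, -Finsupp.sumFinsuppLEquivProdFinsupp_apply]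

theorem coneAug_inl (a : (ι₁ →₀ R) →ₗ[R] R) (p : (κ₁ →₀ R) →ₗ[R] R) (e : ι₁) :
    coneAug a p (Finsupp.single (Sum.inl e) 1) = a (Finsupp.single e 1) := by
  simp [coneAug, sumFinsuppLEquivProdFinsupp_single_inl,
    -Finsupp.sumFinsuppLEquivProdFinsupp_apply]

theorem coneAug_inr (a : (ι₁ →₀ R) →ₗ[R] R) (p : (κ₁ →₀ R) →ₗ[R] R) (e : κ₁) :
    coneAug a p (Finsupp.single (Sum.inr e) 1) = p (Finsupp.single e 1) := by
  simp [coneAug, sumFinsuppLEquivProdFinsupp_single_inr,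
    -Finsupp.sumFinsuppLEquivProdFinsupp_apply]

variable {dA dB ψ}

theorem coneD_symm_apply (a : ι₁ →₀ R) (b : κ₁ →₀ R) :
    coneD dA dB ψ ((Finsupp.sumFinsuppLEquivProdFinsupp R).symm (a, b)) =
      (Finsupp.sumFinsuppLEquivProdFinsupp R).symm (dA a + ψ b, -dB b) := by
  rw [coneD, LinearMap.comp_apply, LinearMap.comp_apply, LinearEquiv.coe_coe,
    LinearEquiv.coe_coe, LinearEquiv.apply_symm_apply]
  rfl

theorem coneAug_symm_apply {a : (ι₀ →₀ R) →ₗ[R] R} {p : (κ₀ →₀ R) →ₗ[R] R} (x : ι₀ →₀ R)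
    (y : κ₀ →₀ R) :
    coneAug a p ((Finsupp.sumFinsuppLEquivProdFinsupp R).symm (x, y)) = a x + p y := by
  rw [coneAug, LinearMap.comp_apply, LinearEquiv.coe_coe, LinearEquiv.apply_symm_apply]
  rfl

theorem exact_coneD {ι₂ κ₂ : Type*} {dA' : (ι₂ →₀ R) →ₗ[R] (ι₁ →₀ R)}
    {dB' : (κ₂ →₀ R) →ₗ[R] (κ₁ →₀ R)} {ψ' : (κ₂ →₀ R) →ₗ[R] (ι₁ →₀ R)}
    (hA : Function.Exact dA' dA) (hB : Function.Exact dB' dB) (hψ : dA ∘ₗ ψ' = ψ ∘ₗ dB') :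
    Function.Exact (coneD dA' dB' ψ') (coneD dA dB ψ) := by
  intro z
  obtain ⟨⟨a, b⟩, rfl⟩ := (Finsupp.sumFinsuppLEquivProdFinsupp R).symm.surjective z
  rw [coneD_symm_apply, LinearEquiv.map_eq_zero_iff, Prod.mk_eq_zero, neg_eq_zero]
  constructor
  · rintro ⟨h, hb⟩
    obtain ⟨a', b', h1, h2⟩ := cone_exists_preimage hA hψ h ((hB b).mp hb)
    exact ⟨(Finsupp.sumFinsuppLEquivProdFinsupp R).symm (a', b'), by
      rw [coneD_symm_apply, h1, h2]⟩
  · rintro ⟨w, hw⟩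
    obtain ⟨⟨a', b'⟩, rfl⟩ := (Finsupp.sumFinsuppLEquivProdFinsupp R).symm.surjective w
    rw [coneD_symm_apply, EmbeddingLike.apply_eq_iff_eq, Prod.mk.injEq] at hw
    rw [← hw.1, ← hw.2, map_add, map_neg, map_neg, hA.apply_apply_eq_zero,
      hB.apply_apply_eq_zero, ← LinearMap.comp_apply, hψ, LinearMap.comp_apply]
    simp

theorem exact_coneAug {a : (ι₀ →₀ R) →ₗ[R] R} {p : (κ₀ →₀ R) →ₗ[R] R}
    (hA : Function.Exact dA a) (hψ : a ∘ₗ ψ = p ∘ₗ dB)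
    (hp : ∀ x y, a x + p y = 0 → y ∈ Set.range dB) :
    Function.Exact (coneD dA dB ψ) (coneAug a p) := by
  intro z
  obtain ⟨⟨x, y⟩, rfl⟩ := (Finsupp.sumFinsuppLEquivProdFinsupp R).symm.surjective z
  rw [coneAug_symm_apply]
  constructor
  · intro h
    obtain ⟨a', b', h1, h2⟩ := cone_exists_preimage hA hψ h (hp x y h)
    exact ⟨(Finsupp.sumFinsuppLEquivProdFinsupp R).symm (a', b'), by
      rw [coneD_symm_apply, h1, h2]⟩
  · rintro ⟨w, hw⟩
    obtain ⟨⟨a', b'⟩, rfl⟩ := (Finsupp.sumFinsuppLEquivProdFinsupp R).symm.surjective w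
    rw [coneD_symm_apply, EmbeddingLike.apply_eq_iff_eq, Prod.mk.injEq] at hw
    rw [← hw.1, ← hw.2, map_add, map_neg, hA.apply_apply_eq_zero, ← LinearMap.comp_apply, hψ,
      LinearMap.comp_apply]
    simp

theorem range_coneAug (a : (ι₀ →₀ R) →ₗ[R] R) (p : (κ₀ →₀ R) →ₗ[R] R) :
    LinearMap.range (coneAug a p) = LinearMap.range a ⊔ LinearMap.range p := by
  rw [coneAug, LinearMap.range_comp, LinearEquiv.range, Submodule.map_top, LinearMap.range_coprod]

end Cone

namespace GradedFreeResolution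

variable {K : Type*} [Field K] {n : ℕ} {J Q : Ideal (MvPolynomial (Fin n) K)}

theorem isMinimal_entry {f : MvPolynomial (Fin n) K} {c c' : ℤ}
    (h : ∀ m ∈ f.support, (m.degree : ℤ) + c = c') (hlt : c < c') :
    f ∈ idealOfVars (Fin n) K :=
  mem_idealOfVars_of_degree_pos fun m hm => by
    have := h m hm
    omega

/-- The mapping cone: a resolution of `J + (u)` from resolutions of `J` and of `J : u`, where the
latter is linear. -/
theorem exists_cone (F : GradedFreeResolution J) (G : GradedFreeResolution Q)
    (hF : F.IsMinimal) (hG : ∀ i e, G.deg i e = (i : ℤ) + 1)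
    {u : MvPolynomial (Fin n) K} {D : ℤ} (hu : ∀ m ∈ u.support, (m.degree : ℤ) = D)
    (hQ : J.colon {u} = Q) (hD : ∀ i e, F.deg i e ≤ D + i) :
    ∃ H : GradedFreeResolution (J ⊔ Ideal.span {u}), H.IsMinimal ∧
      ∀ i e, (∃ e', H.deg i e = F.deg i e') ∨ H.deg i e = D + i := by
  have hmemQ : ∀ q, q ∈ Q ↔ q * u ∈ J := fun q => by
    rw [← hQ, Submodule.mem_colon_singleton, smul_eq_mul]
  obtain ⟨ψ, hψ0, hψ, hψhom⟩ := F.exists_chainMap G hu fun q hq => (hmemQ q).mp hq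
  have haugDeg : ∀ i e, G.augDeg i e = i := by
    intro i e
    cases i with
    | zero => rfl
    | succ i => exact (hG i e).trans (by push_cast; ring)
  let p : (G.augι 0 →₀ MvPolynomial (Fin n) K) →ₗ[MvPolynomial (Fin n) K]
      MvPolynomial (Fin n) K := u • Finsupp.lapply (() : Unit)
  have hp : ∀ b : Unit →₀ MvPolynomial (Fin n) K, p b = u * b () := fun b => rfl
  -- `F.augι (i + 1)` is `F.ι i`, so F_i is paired with the i-th module of the resolution of S / Q.
  -- The shift by D puts the generator of S / Q in the degree of u.
  let H : GradedFreeResolution (J ⊔ Ideal.span {u}) :=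
    { ι := fun i => F.ι i ⊕ G.augι i
      finite_basis := fun i => by
        have := F.finite_basis i
        have := G.finite_augι i
        infer_instance
      deg := fun i => Sum.elim (F.deg i) fun e => G.augDeg i e + D
      aug := coneAug F.aug p
      d := fun i => coneD (F.d i) (G.augD i) (ψ (i + 1))
      range_aug := by
        rw [range_coneAug, F.range_aug]
        congr 1
        apply le_antisymm
        · rintro _ ⟨b, rfl⟩
          exact Ideal.mul_mem_right _ _ (Ideal.mem_span_singleton_self u)
        · refine (Ideal.span_singleton_le_iff_mem _).mpr
            ⟨(Finsupp.single () 1 : Unit →₀ MvPolynomial (Fin n) K), ?_⟩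
          refine (hp _).trans ?_
          rw [Finsupp.single_eq_same, mul_one]
      exact_zero := by
        refine exact_coneAug F.exact_zero ?_ ?_
        · ext1 e
          apply LinearMap.ext_ring
          have h := LinearMap.congr_fun (hψ 0) (Finsupp.single e 1)
          simp only [LinearMap.comp_apply] at h
          refine ((Finsupp.single_eq_same (a := ()) (b := F.aug _)).symm.trans
            ((DFunLike.congr_fun h ()).trans ?_))
          exact DFunLike.congr_fun (hψ0 _) ()
        -- A relation makes u y an element of J, so y lies in the colon ideal, which `G` resolves.
        · intro x y hxy
          have hy : (y : Unit →₀ MvPolynomial (Fin n) K) () ∈ Q := by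
            rw [hmemQ]
            have h1 : F.aug x ∈ J := F.range_aug.le (LinearMap.mem_range_self F.aug x)
            have h2 : (y : Unit →₀ MvPolynomial (Fin n) K) () * u = - F.aug x := by
              rw [mul_comm]
              exact eq_neg_of_add_eq_zero_right hxy
            rw [h2]
            exact J.neg_mem h1
          obtain ⟨w, hw⟩ := G.range_aug.ge hy
          refine ⟨w, ?_⟩
          apply Finsupp.ext
          intro e
          exact (Finsupp.single_eq_same (a := ()) (b := G.aug w)).trans hw
      exact_succ := fun i => exact_coneD (F.exact_succ i) (G.exact_augD i) (hψ (i + 1))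
      homogeneous_aug := by
        rintro (e | e) m hm
        · rw [coneAug_inl] at hm
          exact F.homogeneous_aug e m hm
        · rw [coneAug_inr] at hm
          have h : p (Finsupp.single e 1) = u :=
            (congrArg (u * ·) (Finsupp.single_eq_same (a := ()) (b := 1))).trans (mul_one u)
          rw [h] at hm
          exact (hu m hm).trans (zero_add D).symm
      homogeneous_d := by
        rintro i (e | e) (e' | e') m hm
        · rw [coneD_inl_inl] at hm
          exact F.homogeneous_d i e e' m hm
        · rw [coneD_inl_inr] at hm
          simp at hm
        · rw [coneD_inr_inl] at hm
          exact hψhom (i + 1) e e' m hm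
        · rw [coneD_inr_inr, support_neg] at hm
          have := G.isHomogeneousMap_augD i e e' m hm
          simp only [Sum.elim_inr]
          omega }
  refine ⟨H, ?_, ?_⟩
  · rintro i (e | e) (e' | e')
    · change coneD _ _ _ _ _ ∈ _
      rw [coneD_inl_inl]
      exact hF i e e'
    · change coneD _ _ _ _ _ ∈ _
      rw [coneD_inl_inr]
      exact Ideal.zero_mem _
    -- Here `hD` is needed: the source has degree D + i + 1 and the target at most D + i, so no
    -- entry has a constant term.
    · refine isMinimal_entry (H.homogeneous_d i (Sum.inr e) (Sum.inl e')) ?_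
      have h1 := hD i e'
      have h2 := haugDeg (i + 1) e
      change F.deg i e' < G.augDeg (i + 1) e + D
      push_cast at h2
      omega
    · refine isMinimal_entry (H.homogeneous_d i (Sum.inr e) (Sum.inr e')) ?_
      have h1 := haugDeg i e'
      have h2 := haugDeg (i + 1) e
      change G.augDeg i e' + D < G.augDeg (i + 1) e + D
      push_cast at h2
      omega
  · rintro i (e | e)
    · exact Or.inl ⟨e, rfl⟩
    · right
      have h := haugDeg i e
      change G.augDeg i e + D = _
      omega

theorem exists_bot : ∃ F : GradedFreeResolution (⊥ : Ideal (MvPolynomial (Fin n) K)),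
    F.IsMinimal ∧ ∀ i, IsEmpty (F.ι i) :=
  ⟨{ ι := fun _ => Empty
     finite_basis := fun _ => inferInstance
     deg := fun _ => Empty.elim
     aug := 0
     d := fun _ => 0
     range_aug := LinearMap.range_zero
     exact_zero := fun _ => ⟨fun _ => ⟨0, Subsingleton.elim _ _⟩, fun _ => rfl⟩
     exact_succ := fun _ _ => ⟨fun _ => ⟨0, Subsingleton.elim _ _⟩, fun _ => rfl⟩
     homogeneous_aug := fun e => e.elim
     homogeneous_d := fun _ e => e.elim }, fun _ e => e.elim,
    fun _ => inferInstanceAs (IsEmpty Empty)⟩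

theorem span_X_colon {A : Set (Fin n)} {x : Fin n} (hx : x ∉ A) :
    (Ideal.span (X '' A) : Ideal (MvPolynomial (Fin n) K)).colon {X x} =
      Ideal.span (X '' A) := by
  ext f
  rw [Submodule.mem_colon_singleton, smul_eq_mul, mem_ideal_span_X_image, mem_ideal_span_X_image]
  change (∀ m ∈ (f * monomial (Finsupp.single x 1) 1).support, _) ↔ _
  simp only [support_mul_monomial_one]
  have key : ∀ (a : Fin n →₀ ℕ), ∀ i ∈ A, (a + Finsupp.single x 1 : Fin n →₀ ℕ) i = a i := by
    intro a i hi
    have : i ≠ x := fun h => hx (h ▸ hi)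
    simp [this]
  constructor
  · intro h a ha
    obtain ⟨i, hi, hne⟩ := h _ ⟨a, ha, rfl⟩
    exact ⟨i, hi, by rwa [key a i hi] at hne⟩
  · rintro h _ ⟨a, ha, rfl⟩
    obtain ⟨i, hi, hne⟩ := h a ha
    exact ⟨i, hi, by rwa [key a i hi]⟩

/-- Ideals generated by variables have linear resolutions. -/
theorem exists_span_X (A : Set (Fin n)) :
    ∃ F : GradedFreeResolution (Ideal.span (X '' A) : Ideal (MvPolynomial (Fin n) K)),
      F.IsMinimal ∧ ∀ i e, F.deg i e = (i : ℤ) + 1 := by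
  induction A, A.toFinite using Set.Finite.induction_on with
  | empty =>
    rw [Set.image_empty, Ideal.span_empty]
    obtain ⟨F, hF, hempty⟩ := exists_bot (K := K) (n := n)
    exact ⟨F, hF, fun i e => ((hempty i).false e).elim⟩
  | @insert x A hx _ ih =>
    obtain ⟨F, hF, hdeg⟩ := ih
    -- A new variable is a nonzerodivisor modulo the old ones, so the colon ideal is the old ideal
    -- and the cone joins `F` to itself, as in the Koszul complex.
    obtain ⟨H, hH, hHdeg⟩ := F.exists_cone F hF hdeg (u := X x) (D := 1) (fun m hm => by
      rw [support_X, Finset.mem_singleton] at hm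
      simp [hm]) (span_X_colon hx) (fun i e => by rw [hdeg]; omega)
    rw [Set.image_insert_eq, Ideal.span_insert, sup_comm]
    refine ⟨H, hH, fun i e => ?_⟩
    rcases hHdeg i e with ⟨e', h⟩ | h
    · rw [h, hdeg]
    · rw [h, add_comm]

/-- An ideal with linear quotients with respect to monomials of nondecreasing degrees has a
minimal resolution whose degrees come from those of the generators. -/
theorem exists_of_linearQuotients {m : ℕ} (u : Fin m → (Fin n →₀ ℕ))
    (hmono : ∀ i j, i < j → (u i).degree ≤ (u j).degree)
    (hcolon : ∀ i : Fin m, ∃ A : Set (Fin n),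
        (monomialIdeal K (u '' {j | j < i})).colon {monomial (u i) (1 : K)} =
          Ideal.span (X '' A)) :
    ∃ F : GradedFreeResolution (monomialIdeal K (Set.range u)), F.IsMinimal ∧
      ∀ i e, ∃ j, F.deg i e = ((u j).degree : ℤ) + i := by
  suffices h : ∀ t ≤ m, ∃ F : GradedFreeResolution
      (monomialIdeal K (u '' {j | (j : ℕ) < t})), F.IsMinimal ∧
      ∀ i e, ∃ j : Fin m, (j : ℕ) < t ∧ F.deg i e = ((u j).degree : ℤ) + i by
    obtain ⟨F, hF, hdeg⟩ := h m le_rfl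
    have : {j : Fin m | (j : ℕ) < m} = Set.univ := Set.eq_univ_of_forall fun j => j.2
    rw [← Set.image_univ, ← this]
    exact ⟨F, hF, fun i e => (hdeg i e).imp fun j hj => hj.2⟩
  intro t
  induction t with
  | zero =>
    intro _
    obtain ⟨F, hF, hempty⟩ := exists_bot (K := K) (n := n)
    have : monomialIdeal K (u '' {j | (j : ℕ) < 0}) = ⊥ := by
      simp [monomialIdeal]
    rw [this]
    exact ⟨F, hF, fun i e => ((hempty i).false e).elim⟩
  | succ t ih =>
    intro ht
    obtain ⟨F, hF, hdeg⟩ := ih (Nat.le_of_succ_le ht)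
    let v : Fin m := ⟨t, ht⟩
    obtain ⟨A, hA⟩ := hcolon v
    obtain ⟨G, -, hG⟩ := exists_span_X (K := K) A
    obtain ⟨H, hH, hHdeg⟩ := F.exists_cone G hF hG (u := monomial (u v) 1)
      (D := (u v).degree) (fun b hb => by
        rw [Finset.mem_singleton.mp (support_monomial_subset hb)]) hA (fun i e => by
        obtain ⟨j, hj, h⟩ := hdeg i e
        have := hmono j v hj
        omega)
    have hJ : monomialIdeal K (u '' {j | (j : ℕ) < t + 1}) =
        monomialIdeal K (u '' {j | (j : ℕ) < t}) ⊔ Ideal.span {monomial (u v) 1} := by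
      have hset : {j : Fin m | (j : ℕ) < t + 1} = insert v {j : Fin m | (j : ℕ) < t} := by
        ext j
        simp only [Set.mem_ofPred_eq, Set.mem_insert_iff, Fin.ext_iff, v]
        omega
      rw [hset, Set.image_insert_eq, monomialIdeal, Set.image_insert_eq, Ideal.span_insert,
        sup_comm, monomialIdeal]
    rw [hJ]
    refine ⟨H, hH, fun i e => ?_⟩
    rcases hHdeg i e with ⟨e', h⟩ | h
    · obtain ⟨j, hj, h'⟩ := hdeg i e'
      exact ⟨j, Nat.lt_succ_of_lt hj, h.trans h'⟩
    · exact ⟨v, Nat.lt_succ_self t, h⟩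

end GradedFreeResolution

/-! ### Componentwise linearity and regularity of balanced monomial ideals -/

section Balanced

variable {K : Type*} [Field K] {n : ℕ} {G : Set (Fin n →₀ ℕ)}

theorem IsBalanced.exists_resolution (hG : IsBalanced G) :
    ∃ F : GradedFreeResolution (monomialIdeal K G), F.IsMinimal ∧
      ∀ i e, ∃ a, Minimal (· ∈ G) a ∧ F.deg i e = (a.degree : ℤ) + i := by
  obtain ⟨m, u, -, hrange, hmono, hcolon⟩ := hG.exists_linearQuotients (K := K)
  obtain ⟨F, hF, hdeg⟩ := GradedFreeResolution.exists_of_linearQuotients u hmono hcolon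
  rw [← monomialIdeal_setOf_minimal, ← hrange]
  exact ⟨F, hF, fun i e => (hdeg i e).elim fun j hj => ⟨u j, hrange.subset ⟨j, rfl⟩, hj⟩⟩

theorem IsBalanced.isComponentwiseLinear (hG : IsBalanced G) (hup : IsUpperSet G) :
    IsComponentwiseLinear (monomialIdeal K G) := by
  refine ⟨fun f hf j => homogeneousComponent_mem_monomialIdeal hf j, fun j => ?_⟩
  -- The upper closure of the degree slice generates the same ideal, is still balanced, and has all
  -- its minimal elements in degree j.
  rw [degreeComponentIdeal_monomialIdeal hup, ← monomialIdeal_upperClosure]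
  obtain ⟨F, hF, hdeg⟩ := (hG.inter_degree j).upperClosure.exists_resolution (K := K)
  refine ⟨j, F, hF, fun i e => ?_⟩
  obtain ⟨a, ha, h⟩ := hdeg i e
  rw [h, (minimal_upperClosure_subset ha).2]

/-- A minimal monomial generator of degree `D` contributes a generator of degree `D` to every
graded free resolution. -/
theorem GradedFreeResolution.exists_deg_eq (hup : IsUpperSet G)
    (F : GradedFreeResolution (monomialIdeal K G)) {a : Fin n →₀ ℕ} (ha : Minimal (· ∈ G) a) :
    ∃ e, F.deg 0 e = a.degree := by
  classical
  have hmem : monomial a (1 : K) ∈ monomialIdeal K G :=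
    monomial_mem_monomialIdeal.mpr ⟨a, ha.1, le_rfl⟩
  obtain ⟨z, hz⟩ := F.range_aug.ge hmem
  have hsum : z.sum (fun e p => p * F.aug (Finsupp.single e 1)) = monomial a 1 := by
    rw [← hz]
    conv_rhs => rw [← Finsupp.sum_single z]
    rw [map_finsuppSum]
    refine Finsupp.sum_congr fun e _ => ?_
    rw [← smul_eq_mul, ← map_smul, Finsupp.smul_single, smul_eq_mul, mul_one]
  -- Comparing coefficients at a, the image of some basis element contains a monomial dividing x^a,
  -- which is x^a itself by minimality.
  have hcoeff := congrArg (coeff a) hsum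
  rw [Finsupp.sum, coeff_sum, coeff_monomial, if_pos rfl] at hcoeff
  obtain ⟨e, -, he⟩ := Finset.exists_ne_zero_of_sum_ne_zero (hcoeff ▸ one_ne_zero)
  rw [coeff_mul] at he
  obtain ⟨⟨b, c⟩, hbc, hne⟩ := Finset.exists_ne_zero_of_sum_ne_zero he
  rw [Finset.HasAntidiagonal.mem_antidiagonal] at hbc
  have hc : c ∈ (F.aug (Finsupp.single e 1)).support :=
    mem_support_iff.mpr (right_ne_zero_of_mul hne)
  have hcG : c ∈ G := (mem_monomialIdeal_of_isUpperSet hup).mp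
    (F.range_aug.le (LinearMap.mem_range_self F.aug _)) c hc
  have hle : c ≤ a := hbc ▸ le_add_self
  have hac : c = a := le_antisymm hle (ha.2 hcG hle)
  exact ⟨e, by rw [← F.homogeneous_aug e c hc, hac]⟩

/-- The cone resolution bounds the infimum in `regularity` from above. Every resolution has a
generator of degree D in position 0, which bounds it from below; uniqueness of minimal resolutions
plays no role. -/
theorem IsBalanced.regularity_eq (hG : IsBalanced G) (hup : IsUpperSet G) {D : ℕ}
    (hle : ∀ a, Minimal (· ∈ G) a → a.degree ≤ D) (hex : ∃ a, Minimal (· ∈ G) a ∧ a.degree = D) :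
    regularity (monomialIdeal K G) = (D : EReal) := by
  apply le_antisymm
  · obtain ⟨F, hF, hdeg⟩ := hG.exists_resolution (K := K)
    refine iInf₂_le_of_le F hF (iSup₂_le fun i e => ?_)
    obtain ⟨a, ha, h⟩ := hdeg i e
    rw [h, add_sub_cancel_right, Int.cast_natCast]
    exact_mod_cast hle a ha
  · refine le_iInf₂ fun F _ => ?_
    obtain ⟨a, ha, rfl⟩ := hex
    obtain ⟨e, he⟩ := F.exists_deg_eq hup ha
    refine le_iSup₂_of_le 0 e ?_
    rw [he]
    simp

end Balanced

/-! ### Symbolic powers -/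

section Symbolic

variable {R : Type*} [CommRing R]

theorem mem_symbolicPower {I : Ideal R} {k : ℕ} {f : R} :
    f ∈ symbolicPower I k ↔ ∀ P ∈ associatedPrimes R (R ⧸ I), ∃ s ∉ P, s * f ∈ I ^ k := by
  rw [symbolicPower, Ideal.mem_iInf]
  constructor
  · intro h P hP
    have := hP.1
    obtain ⟨s, hs, h⟩ := (IsLocalization.algebraMap_mem_map_algebraMap_iff P.primeCompl _ _ _).mp
      (h ⟨P, hP⟩)
    exact ⟨s, hs, h⟩
  · rintro h ⟨P, hP⟩
    have := hP.1
    obtain ⟨s, hs, h⟩ := h P hP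
    exact (IsLocalization.algebraMap_mem_map_algebraMap_iff P.primeCompl _ _ _).mpr ⟨s, hs, h⟩

theorem mem_associatedPrimes_quotient [IsNoetherianRing R] {I P : Ideal R} :
    P ∈ associatedPrimes R (R ⧸ I) ↔ P.IsPrime ∧ ∃ g, ∀ r, r ∈ P ↔ r * g ∈ I := by
  rw [AssociatedPrimes.mem_iff, isAssociatedPrime_iff]
  refine and_congr_right fun _ => ?_
  rw [(Ideal.Quotient.mk_surjective (I := I)).exists]
  refine exists_congr fun g => ?_
  rw [SetLike.ext_iff]
  refine forall_congr' fun r => ?_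
  rw [Submodule.mem_colon_singleton, Submodule.mem_bot, ← Ideal.Quotient.eq_zero_iff_mem (I := I), map_mul]
  rfl

/-- In a domain the zero ideal is itself an associated prime, with witness 1. For k = 0 the power
would be the unit ideal. -/
theorem symbolicPower_bot [IsDomain R] {k : ℕ} (hk : k ≠ 0) [IsNoetherianRing R] :
    symbolicPower (⊥ : Ideal R) k = ⊥ := by
  rw [eq_bot_iff]
  intro f hf
  obtain ⟨s, hs, h⟩ := mem_symbolicPower.mp hf ⊥
    (mem_associatedPrimes_quotient.mpr ⟨Ideal.isPrime_bot, 1, fun r => by rw [mul_one]⟩)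
  rw [Ideal.bot_pow hk] at h
  exact (mul_eq_zero.mp h).resolve_left hs

end Symbolic

/-! ### Powers of squarefree Veronese ideals -/

section Veronese

variable {K : Type*} [Field K] {n : ℕ}

/-- The exponent vector of the squarefree monomial with support `A`. -/
noncomputable def indicatorVector (A : Finset (Fin n)) : Fin n →₀ ℕ :=
  ∑ i ∈ A, Finsupp.single i 1

theorem indicatorVector_apply (A : Finset (Fin n)) (i : Fin n) :
    indicatorVector A i = if i ∈ A then 1 else 0 := by
  simp [indicatorVector, Finsupp.finsetSum_apply, Finsupp.single_apply]

theorem degree_indicatorVector (A : Finset (Fin n)) : (indicatorVector A).degree = A.card := by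
  simp [degree_eq_sum_univ, indicatorVector_apply]

theorem monomial_indicatorVector (A : Finset (Fin n)) :
    monomial (indicatorVector A) (1 : K) = ∏ i ∈ A, X i :=
  monomial_sum_one A _

/-- The exponent vectors of degree `d * k` with all coordinates at most `k`. -/
def veroneseType (n d k : ℕ) : Set (Fin n →₀ ℕ) := {b | b.degree = d * k ∧ ∀ i, b i ≤ k}

theorem indicatorVector_mem_veroneseType {A : Finset (Fin n)} {d : ℕ} (h : A.card = d) :
    indicatorVector A ∈ veroneseType n d 1 := by
  refine ⟨by rw [degree_indicatorVector, h, mul_one], fun i => ?_⟩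
  rw [indicatorVector_apply]
  split_ifs <;> simp

theorem eq_indicatorVector_of_le_one {b : Fin n →₀ ℕ} (h : ∀ i, b i ≤ 1) :
    b = indicatorVector b.support := by
  ext i
  rw [indicatorVector_apply]
  have := h i
  split_ifs with hi
  · rw [Finsupp.mem_support_iff] at hi
    omega
  · exact Finsupp.notMem_support_iff.mp hi

theorem squarefreeVeronese_eq_monomialIdeal (d : ℕ) :
    squarefreeVeronese K n d = monomialIdeal K (veroneseType n d 1) := by
  rw [squarefreeVeronese, monomialIdeal]
  congr 1
  ext f
  constructor
  · rintro ⟨A, hA, rfl⟩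
    exact ⟨indicatorVector A, indicatorVector_mem_veroneseType hA, monomial_indicatorVector A⟩
  · rintro ⟨b, ⟨hdeg, hle⟩, rfl⟩
    have hb := eq_indicatorVector_of_le_one hle
    refine ⟨b.support, ?_, ?_⟩
    · rw [← degree_indicatorVector, ← hb, hdeg, mul_one]
    · rw [← monomial_indicatorVector, ← hb]

theorem exists_mem_veroneseType_one_le_iff {d : ℕ} {a : Fin n →₀ ℕ} :
    (∃ b ∈ veroneseType n d 1, b ≤ a) ↔ d ≤ a.support.card := by
  constructor
  · rintro ⟨b, ⟨hdeg, hle⟩, hba⟩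
    rw [eq_indicatorVector_of_le_one hle, degree_indicatorVector, mul_one] at hdeg
    rw [← hdeg]
    exact Finset.card_le_card (Finsupp.support_mono hba)
  · intro h
    obtain ⟨A, hA, hcard⟩ := Finset.exists_subset_card_eq h
    refine ⟨indicatorVector A, indicatorVector_mem_veroneseType hcard, fun i => ?_⟩
    rw [indicatorVector_apply]
    split_ifs with hi
    · exact Nat.one_le_iff_ne_zero.mpr (Finsupp.mem_support_iff.mp (hA hi))
    · exact Nat.zero_le _

theorem veroneseType_isBalanced (d k : ℕ) : IsBalanced (veroneseType n d k) := by
  rintro b i j hij ⟨hdeg, hle⟩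
  refine ⟨by rw [degree_add_single] at hdeg ⊢; exact hdeg, fun l => ?_⟩
  have hl := hle l
  have hj := hle j
  simp only [Finsupp.add_apply, Finsupp.single_eq_same] at hj hl ⊢
  by_cases h : l = i
  · subst h
    rw [Finsupp.single_eq_same]
    omega
  · rw [Finsupp.single_eq_of_ne h]
    omega

/-- A vector of Veronese type splits off a squarefree one. -/
theorem exists_split_veroneseType {d k : ℕ} {b : Fin n →₀ ℕ}
    (hb : b ∈ veroneseType n d (k + 1)) :
    ∃ c ∈ veroneseType n d k, ∃ a ∈ veroneseType n d 1, c + a = b := by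
  classical
  obtain ⟨hdeg, hle⟩ := hb
  -- The squarefree factor must use every coordinate equal to k + 1 and stay inside the support.
  -- Counting the degree d(k + 1) shows that a set of size d fits between the two.
  have hsub : (Finset.univ.filter fun i => b i = k + 1) ⊆ b.support := fun i hi => by
    rw [Finsupp.mem_support_iff, (Finset.mem_filter.mp hi).2]
    omega
  have hcard1 : (Finset.univ.filter fun i => b i = k + 1).card ≤ d := by
    have h : (Finset.univ.filter fun i => b i = k + 1).card * (k + 1) ≤ d * (k + 1) := by
      rw [← hdeg, degree_eq_sum_univ, ← smul_eq_mul]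
      refine (Finset.card_nsmul_le_sum _ (fun i => b i) _ fun i hi => ?_).trans
        (Finset.sum_le_sum_of_subset (Finset.subset_univ _))
      exact (Finset.mem_filter.mp hi).2.ge
    exact Nat.le_of_mul_le_mul_right h (Nat.succ_pos k)
  have hcard2 : d ≤ b.support.card := by
    have h : d * (k + 1) ≤ b.support.card * (k + 1) := by
      rw [← hdeg, Finsupp.degree_apply, ← smul_eq_mul]
      exact Finset.sum_le_card_nsmul _ _ _ fun i _ => hle i
    exact Nat.le_of_mul_le_mul_right h (Nat.succ_pos k)
  obtain ⟨A, hA1, hA2, hA⟩ := Finset.exists_subsuperset_card_eq hsub hcard1 hcard2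
  have hAb : indicatorVector A ≤ b := fun i => by
    rw [indicatorVector_apply]
    split_ifs with hi
    · exact Nat.one_le_iff_ne_zero.mpr (Finsupp.mem_support_iff.mp (hA2 hi))
    · exact Nat.zero_le _
  obtain ⟨c, rfl⟩ := le_iff_exists_add.mp hAb
  refine ⟨c, ⟨?_, fun i => ?_⟩, indicatorVector A, indicatorVector_mem_veroneseType hA,
    add_comm _ _⟩
  · rw [map_add, degree_indicatorVector, hA] at hdeg
    rw [Nat.mul_succ] at hdeg
    omega
  · have hi := hle i
    by_cases h : i ∈ A
    · rw [Finsupp.add_apply, indicatorVector_apply, if_pos h] at hi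
      omega
    · have : (indicatorVector A + c) i ≠ k + 1 := fun heq =>
        h (hA1 (Finset.mem_filter.mpr ⟨Finset.mem_univ i, heq⟩))
      rw [Finsupp.add_apply] at this hi
      omega

theorem squarefreeVeronese_pow (d k : ℕ) :
    squarefreeVeronese K n d ^ k = monomialIdeal K (veroneseType n d k) := by
  induction k with
  | zero =>
    rw [pow_zero, Ideal.one_eq_top, eq_comm, Ideal.eq_top_iff_one]
    refine Ideal.subset_span ⟨0, ⟨by simp, fun i => le_rfl⟩, rfl⟩
  | succ k ih =>
    rw [pow_succ, ih, squarefreeVeronese_eq_monomialIdeal, monomialIdeal, monomialIdeal,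
      Ideal.span_mul_span', monomialIdeal]
    congr 1
    ext f
    constructor
    · rintro ⟨_, ⟨c, hc, rfl⟩, _, ⟨a, ha, rfl⟩, rfl⟩
      refine ⟨c + a, ⟨?_, fun i => ?_⟩, ?_⟩
      · rw [map_add, hc.1, ha.1]
        ring
      · exact add_le_add (hc.2 i) (ha.2 i)
      · simp [monomial_mul]
    · rintro ⟨b, hb, rfl⟩
      obtain ⟨c, hc, a, ha, rfl⟩ := exists_split_veroneseType hb
      exact ⟨_, ⟨c, hc, rfl⟩, _, ⟨a, ha, rfl⟩, by simp [monomial_mul]⟩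

/-! ### Exponents of the symbolic powers: balance and degrees of generators. -/

/-- The exponent vectors of the monomials in the symbolic power: the sum over every complement
of a set of `d - 1` coordinates is at least `k`. -/
def symbolicExponents (n d k : ℕ) : Set (Fin n →₀ ℕ) :=
  {a | ∀ A : Finset (Fin n), A.card + d = n + 1 → k ≤ ∑ i ∈ A, a i}

theorem symbolicExponents_isUpperSet (d k : ℕ) : IsUpperSet (symbolicExponents n d k) :=
  fun _ _ hab ha A hA => (ha A hA).trans (Finset.sum_le_sum fun i _ => hab i)

theorem sum_add_single (A : Finset (Fin n)) (b : Fin n →₀ ℕ) (i : Fin n) :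
    ∑ l ∈ A, (b + Finsupp.single i 1 : Fin n →₀ ℕ) l =
      ∑ l ∈ A, b l + if i ∈ A then 1 else 0 := by
  simp [Finset.sum_add_distrib, Finsupp.single_apply]

/-- The critical sets A contain j but not i. The inequality for A with j replaced by i, together
with b i ≤ b j, gives the one for A. -/
theorem symbolicExponents_isBalanced (d k : ℕ) : IsBalanced (symbolicExponents n d k) := by
  intro b i j hij hb A hA
  rw [sum_add_single]
  have h1 := hb A hA
  rw [sum_add_single] at h1
  split_ifs with hi
  · refine h1.trans ?_
    gcongr
    split_ifs <;> simp
  by_cases hj : j ∈ A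
  · have hiA : i ∉ A.erase j := fun h => hi (Finset.mem_of_mem_erase h)
    have h2 := hb (insert i (A.erase j)) (by
      rw [Finset.card_insert_of_notMem hiA, Finset.card_erase_add_one hj, hA])
    have hji : j ∉ insert i (A.erase j) := by
      have : j ≠ i := fun h => hi (h ▸ hj)
      simp [this]
    rw [sum_add_single, if_neg hji, Finset.sum_insert hiA] at h2
    have h3 := Finset.add_sum_erase A (fun l => b l) hj
    omega
  · rwa [if_neg hj] at h1

/-- Lowering a i by one violates some inequality, which must involve i and have been an equality. -/
theorem exists_tight_of_minimal {d k : ℕ} {a : Fin n →₀ ℕ}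
    (ha : Minimal (· ∈ symbolicExponents n d k) a) {i : Fin n} (hi : 0 < a i) :
    ∃ A : Finset (Fin n), A.card + d = n + 1 ∧ i ∈ A ∧ ∑ l ∈ A, a l = k := by
  obtain ⟨b, rfl⟩ := exists_eq_add_single hi
  have hb : b ∉ symbolicExponents n d k := fun hb => by
    have := ha.2 hb le_self_add i
    simp at this
  rw [symbolicExponents, Set.mem_ofPred_eq] at hb
  push Not at hb
  obtain ⟨A, hA, hlt⟩ := hb
  have h := ha.1 A hA
  rw [sum_add_single] at h
  refine ⟨A, hA, ?_, ?_⟩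
  · by_contra hiA
    rw [if_neg hiA] at h
    omega
  · rw [sum_add_single]
    split_ifs at h ⊢ <;> omega

/-- Tight sets bound every entry by k. One tight set contributes k, and the d - 1 coordinates
outside it at most (d - 1)k. -/
theorem degree_le_of_minimal_symbolicExponents {d k : ℕ} {a : Fin n →₀ ℕ}
    (ha : Minimal (· ∈ symbolicExponents n d k) a) : a.degree ≤ d * k := by
  have hle : ∀ i, a i ≤ k := fun i => by
    rcases Nat.eq_zero_or_pos (a i) with h | h
    · omega
    · obtain ⟨A, -, hiA, hsum⟩ := exists_tight_of_minimal ha h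
      exact hsum ▸ Finset.single_le_sum (f := fun l => a l) (fun _ _ => Nat.zero_le _) hiA
  by_cases h0 : a = 0
  · simp [h0]
  obtain ⟨i, hi⟩ := Finsupp.ne_iff.mp h0
  obtain ⟨A, hA, -, hsum⟩ := exists_tight_of_minimal ha (Nat.pos_of_ne_zero hi)
  have hcompl : Aᶜ.card + 1 = d := by
    have := Finset.card_compl_add_card A
    rw [Fintype.card_fin] at this
    omega
  have h2 : ∑ l ∈ Aᶜ, a l ≤ Aᶜ.card * k := by
    rw [← smul_eq_mul]
    exact Finset.sum_le_card_nsmul _ _ _ fun i _ => hle i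
  rw [degree_eq_sum_univ, ← Finset.sum_add_sum_compl A, hsum, ← hcompl, add_mul]
  omega

/-- The k-th power of a squarefree generator with support T works: every set of n - d + 1
coordinates meets T, and the set Tᶜ ∪ {i} meets it only in i, forcing entry k there. -/
theorem exists_minimal_symbolicExponents {d k : ℕ} (hdn : d ≤ n) :
    ∃ a, Minimal (· ∈ symbolicExponents n d k) a ∧ a.degree = d * k := by
  classical
  obtain ⟨T, -, hT⟩ := Finset.exists_subset_card_eq
    (show d ≤ (Finset.univ : Finset (Fin n)).card by simpa using hdn)
  have happly : ∀ i, (k • indicatorVector T) i = if i ∈ T then k else 0 := fun i => by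
    simp [indicatorVector_apply]
  refine ⟨k • indicatorVector T, ⟨fun A hA => ?_, fun b hb hle i => ?_⟩, ?_⟩
  · obtain ⟨i, hi⟩ : (A ∩ T).Nonempty := by
      rw [← Finset.card_pos]
      have h1 := Finset.card_union_add_card_inter A T
      have h2 := Finset.card_le_univ (A ∪ T)
      rw [Fintype.card_fin] at h2
      omega
    rw [Finset.mem_inter] at hi
    have := Finset.single_le_sum (f := fun l => (k • indicatorVector T) l)
      (fun _ _ => Nat.zero_le _) hi.1
    rw [happly, if_pos hi.2] at this
    exact this
  · rw [happly]
    split_ifs with hi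
    · have hiT : i ∉ Tᶜ := by simpa using hi
      have h := hb (insert i Tᶜ) (by
        rw [Finset.card_insert_of_notMem hiT, Finset.card_compl, Fintype.card_fin, hT]
        omega)
      rw [Finset.sum_insert hiT, Finset.sum_eq_zero, add_zero] at h
      · exact h
      · intro l hl
        have := hle l
        rw [happly, if_neg (Finset.mem_compl.mp hl)] at this
        omega
    · exact Nat.zero_le _
  · rw [map_nsmul, degree_indicatorVector, hT, smul_eq_mul, mul_comm]

/-- The d - 1 coordinates outside A carry at most (d - 1)k of the degree dk. -/
theorem veroneseType_subset_symbolicExponents (d k : ℕ) :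
    veroneseType n d k ⊆ symbolicExponents n d k := by
  rintro b ⟨hdeg, hle⟩ A hA
  have hcompl : Aᶜ.card + 1 = d := by
    have := Finset.card_compl_add_card A
    rw [Fintype.card_fin] at this
    omega
  have h2 : ∑ l ∈ Aᶜ, b l ≤ Aᶜ.card * k := by
    rw [← smul_eq_mul]
    exact Finset.sum_le_card_nsmul _ _ _ fun i _ => hle i
  rw [degree_eq_sum_univ, ← Finset.sum_add_sum_compl A, ← hcompl, add_mul] at hdeg
  omega

/-! ### Orders along primes generated by variables, associated primes, and the symbolic powers. -/

theorem natCast_le_weightedOrder_iff (A : Finset (Fin n)) (f : MvPolynomial (Fin n) K) (k : ℕ) :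
    (k : ℕ∞) ≤ (f : MvPowerSeries (Fin n) K).weightedOrder (fun i => if i ∈ A then 1 else 0) ↔
      ∀ a ∈ f.support, k ≤ ∑ i ∈ A, a i := by
  have hw : ∀ a : Fin n →₀ ℕ,
      Finsupp.weight (fun i => if i ∈ A then 1 else 0) a = ∑ i ∈ A, a i := fun a => by
    rw [Finsupp.weight_apply, Finsupp.sum_fintype _ _ (by simp)]
    simp
  constructor
  · intro h a ha
    have := h.trans (MvPowerSeries.weightedOrder_le _ (d := a)
      (by rwa [coeff_coe, ← mem_support_iff]))
    rw [hw] at this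
    exact_mod_cast this
  · intro h
    refine MvPowerSeries.nat_le_weightedOrder _ fun a ha => ?_
    rw [hw] at ha
    rw [coeff_coe]
    by_contra hne
    exact absurd (h a (mem_support_iff.mpr hne)) (not_le.mpr ha)

theorem mem_span_X_iff_le_weightedOrder (A : Finset (Fin n)) (f : MvPolynomial (Fin n) K) :
    f ∈ Ideal.span (X '' (A : Set (Fin n)) : Set (MvPolynomial (Fin n) K)) ↔
      ((1 : ℕ) : ℕ∞) ≤
        (f : MvPowerSeries (Fin n) K).weightedOrder (fun i => if i ∈ A then 1 else 0) := by
  rw [natCast_le_weightedOrder_iff, mem_ideal_span_X_image]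
  refine forall₂_congr fun a _ => ?_
  rw [Nat.one_le_iff_ne_zero, Ne, Finset.sum_eq_zero_iff]
  push Not
  rfl

/-- The weighted order is additive on products, so a product of two elements of order 0 has order 0.
-/
theorem isPrime_span_X (A : Finset (Fin n)) :
    (Ideal.span (X '' (A : Set (Fin n))) : Ideal (MvPolynomial (Fin n) K)).IsPrime := by
  refine Ideal.isPrime_iff.mpr ⟨?_, fun {f g} h => ?_⟩
  · rw [Ne, Ideal.eq_top_iff_one, mem_ideal_span_X_image]
    intro h
    obtain ⟨i, -, hi⟩ := h 0 (by simp)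
    exact hi rfl
  · rw [mem_span_X_iff_le_weightedOrder, Nat.cast_one, Order.one_le_iff_ne_zero] at h ⊢
    rw [mem_span_X_iff_le_weightedOrder, Nat.cast_one, Order.one_le_iff_ne_zero]
    rw [coe_mul, MvPowerSeries.weightedOrder_mul] at h
    by_contra! hc
    exact h (by rw [hc.1, hc.2, add_zero])

/-- This prime is the colon of the ideal by the product of the d - 1 variables outside A. -/
theorem span_X_mem_associatedPrimes {d : ℕ} {A : Finset (Fin n)} (hA : A.card + d = n + 1) :
    Ideal.span (X '' (A : Set (Fin n))) ∈ associatedPrimes (MvPolynomial (Fin n) K)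
      (MvPolynomial (Fin n) K ⧸ squarefreeVeronese K n d) := by
  classical
  refine mem_associatedPrimes_quotient.mpr ⟨isPrime_span_X A,
    monomial (indicatorVector Aᶜ) 1, fun r => ?_⟩
  have hcard : Aᶜ.card + 1 = d := by
    have := Finset.card_compl_add_card A
    rw [Fintype.card_fin] at this
    omega
  rw [squarefreeVeronese_eq_monomialIdeal, mem_ideal_span_X_image, mem_monomialIdeal]
  simp only [support_mul_monomial_one, exists_mem_veroneseType_one_le_iff]
  have hsupp : ∀ a : Fin n →₀ ℕ, (a + indicatorVector Aᶜ).support = a.support ∪ Aᶜ := by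
    intro a
    ext i
    simp only [Finsupp.mem_support_iff, Finsupp.add_apply, indicatorVector_apply,
      Finset.mem_union]
    split_ifs with h <;> simp [h]
  constructor
  · rintro h _ ⟨a, ha, rfl⟩
    obtain ⟨i, hi, hne⟩ := h a ha
    have hi' : i ∉ Aᶜ := by simpa using hi
    rw [hsupp, ← hcard, ← Finset.card_insert_of_notMem hi']
    refine Finset.card_le_card (Finset.insert_subset ?_ Finset.subset_union_right)
    exact Finset.mem_union_left _ (Finsupp.mem_support_iff.mpr hne)
  · intro h a ha
    have h1 := h _ ⟨a, ha, rfl⟩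
    by_contra! hc
    have hsub : a.support ⊆ Aᶜ := fun i hi => by
      rw [Finset.mem_compl]
      exact fun hiA => Finsupp.mem_support_iff.mp hi (hc i hiA)
    rw [hsupp, Finset.union_eq_right.mpr hsub] at h1
    omega

/-- For an associated prime of a squarefree Veronese ideal, exactly `d - 1` variables lie
outside of it. -/
theorem card_of_mem_associatedPrimes {d : ℕ} (hdn : d ≤ n)
    {P : Ideal (MvPolynomial (Fin n) K)} (hP : P ∈ associatedPrimes (MvPolynomial (Fin n) K)
      (MvPolynomial (Fin n) K ⧸ squarefreeVeronese K n d))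
    {T : Finset (Fin n)} (hT : ∀ i, i ∈ T ↔ X i ∉ P) : T.card + 1 = d := by
  classical
  obtain ⟨hprime, g, hg⟩ := mem_associatedPrimes_quotient.mp hP
  have hlt : T.card < d := by
    by_contra! hge
    obtain ⟨A, hAT, hA⟩ := Finset.exists_subset_card_eq hge
    have hmem : ∏ i ∈ A, X i ∈ P := (hg _).mpr
      (Ideal.mul_mem_right _ _ (Ideal.subset_span ⟨A, hA, rfl⟩))
    obtain ⟨i, hi, hiP⟩ := hprime.prod_mem_iff.mp hmem
    exact (hT i).mp (hAT hi) hiP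
  have hg1 : g ∉ squarefreeVeronese K n d := fun h =>
    hprime.ne_top ((Ideal.eq_top_iff_one P).mpr ((hg 1).mpr (by rwa [one_mul])))
  rw [squarefreeVeronese_eq_monomialIdeal, mem_monomialIdeal] at hg1
  simp only [exists_mem_veroneseType_one_le_iff] at hg1
  push Not at hg1
  obtain ⟨b, hb, hbd⟩ := hg1
  -- The monomial b of g has fewer than d variables, yet x_i g lies in the ideal, so x_i must be the
  -- one missing variable.
  have key : ∀ i, i ∉ T → i ∉ b.support ∧ b.support.card + 1 = d := by
    intro i hi
    have hXi : X i ∈ P := by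
      by_contra h
      exact hi ((hT i).mpr h)
    have hmul := (hg _).mp hXi
    rw [mul_comm, squarefreeVeronese_eq_monomialIdeal, mem_monomialIdeal] at hmul
    have h1 := hmul (b + Finsupp.single i 1)
      ((support_mul_monomial_one g (Finsupp.single i 1) _).mpr ⟨b, hb, rfl⟩)
    rw [exists_mem_veroneseType_one_le_iff] at h1
    have hsub : (b + Finsupp.single i 1).support ⊆ insert i b.support := by
      intro l hl
      rw [Finset.mem_insert, or_iff_not_imp_left]
      intro hne
      simpa [Finsupp.single_eq_of_ne hne] using hl
    have h2 := h1.trans (Finset.card_le_card hsub)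
    have h3 : i ∉ b.support := fun h => by
      rw [Finset.insert_eq_of_mem h] at h2
      omega
    rw [Finset.card_insert_of_notMem h3] at h2
    exact ⟨h3, by omega⟩
  -- Here d ≤ n enters: T has fewer than n elements, so `key` is not vacuous.
  obtain ⟨i, hi⟩ : ∃ i, i ∉ T := by
    by_contra! hall
    have : T = Finset.univ := Finset.eq_univ_of_forall hall
    rw [this, Finset.card_univ, Fintype.card_fin] at hlt
    omega
  have hsub : b.support ⊆ T := fun l hl => by
    by_contra h
    exact (key l h).1 hl
  have := Finset.card_le_card hsub
  have := (key i hi).2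
  omega

/-- The k-th power of the product of the variables in T multiplies x^a into I^k, so it can serve as
a denominator. -/
theorem exists_veroneseType_le {d k : ℕ} {T : Finset (Fin n)} (hT : T.card + 1 = d)
    {a : Fin n →₀ ℕ} (ha : a ∈ symbolicExponents n d k) :
    ∃ b ∈ veroneseType n d k, b ≤ a + k • indicatorVector T := by
  classical
  have hsum := ha Tᶜ (by
    have := Finset.card_compl_add_card T
    rw [Fintype.card_fin] at this
    omega)
  have hdeg : k ≤ (a.filter (· ∉ T)).degree := by
    rw [degree_eq_sum_univ]
    refine (hsum.trans (le_of_eq ?_)).trans (Finset.sum_le_sum_of_subset (Finset.subset_univ Tᶜ))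
    exact Finset.sum_congr rfl fun i hi =>
      (Finsupp.filter_apply_pos (· ∉ T) a (Finset.mem_compl.mp hi)).symm
  -- Degree exactly k keeps the entries off T at most k and makes the total k + (d - 1)k = dk.
  obtain ⟨c, hca, hc⟩ := Finsupp.exists_le_degree_eq _ _ hdeg
  have hcT : ∀ i ∈ T, c i = 0 := fun i hi => by
    have := hca i
    rw [Finsupp.filter_apply_neg (· ∉ T) a (not_not.mpr hi)] at this
    omega
  refine ⟨c + k • indicatorVector T, ⟨?_, fun i => ?_⟩, ?_⟩
  · rw [map_add, map_nsmul, degree_indicatorVector, hc, ← hT, smul_eq_mul]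
    ring
  · simp only [Finsupp.add_apply, Finsupp.smul_apply, indicatorVector_apply, smul_eq_mul]
    split_ifs with hi
    · rw [hcT i hi]
      omega
    · have := Finsupp.le_degree i c
      omega
  · gcongr
    refine hca.trans fun i => ?_
    rw [Finsupp.filter_apply]
    split_ifs <;> simp

theorem symbolicPower_squarefreeVeronese {d : ℕ} (hdn : d ≤ n) (k : ℕ) :
    symbolicPower (squarefreeVeronese K n d) k = monomialIdeal K (symbolicExponents n d k) := by
  classical
  ext f
  rw [mem_symbolicPower, mem_monomialIdeal_of_isUpperSet (symbolicExponents_isUpperSet d k)]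
  constructor
  · intro h a ha A hA
    obtain ⟨s, hs, hsf⟩ := h _ (span_X_mem_associatedPrimes hA)
    rw [squarefreeVeronese_pow, mem_monomialIdeal] at hsf
    rw [mem_span_X_iff_le_weightedOrder, Nat.cast_one, Order.one_le_iff_ne_zero, not_not] at hs
    have hk := (natCast_le_weightedOrder_iff A (s * f) k).mpr fun b hb => by
      obtain ⟨c, hc, hle⟩ := hsf b hb
      exact symbolicExponents_isUpperSet d k hle
        (veroneseType_subset_symbolicExponents d k hc) A hA
    -- An element outside the prime has order 0, so f has the same order as s f.
    rw [coe_mul, MvPowerSeries.weightedOrder_mul, hs, zero_add] at hk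
    exact (natCast_le_weightedOrder_iff A f k).mp hk a ha
  · intro h P hP
    have hprime : P.IsPrime := hP.1
    let T : Finset (Fin n) := Finset.univ.filter fun i => X i ∉ P
    have hT : ∀ i, i ∈ T ↔ X i ∉ P := fun i => by simp [T]
    -- Of P only the number d - 1 of variables outside it is used; its exact form need not be
    -- determined.
    refine ⟨monomial (k • indicatorVector T) 1, ?_, ?_⟩
    · have hpow : monomial (k • indicatorVector T) (1 : K) = (∏ i ∈ T, X i) ^ k := by
        rw [← monomial_indicatorVector, monomial_pow, one_pow]
      rw [hpow]
      intro hmem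
      obtain ⟨i, hi, hiP⟩ := hprime.prod_mem_iff.mp (hprime.mem_of_pow_mem k hmem)
      exact (hT i).mp hi hiP
    · rw [mul_comm, squarefreeVeronese_pow, mem_monomialIdeal]
      intro b hb
      obtain ⟨a, ha, rfl⟩ := (support_mul_monomial_one _ _ _).mp hb
      exact exists_veroneseType_le (card_of_mem_associatedPrimes hdn hP hT) (h a ha)

theorem squarefreeVeronese_eq_bot {d : ℕ} (h : n < d) : squarefreeVeronese K n d = ⊥ := by
  rw [squarefreeVeronese, Ideal.span_eq_bot]
  rintro _ ⟨A, hA, -⟩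
  have := Finset.card_le_univ A
  rw [Fintype.card_fin] at this
  omega

/-- The symbolic powers of squarefree Veronese ideals are monomial ideals of balanced sets. -/
theorem exists_symbolicPower_eq (d : ℕ) {k : ℕ} (hk : 1 ≤ k) :
    ∃ G : Set (Fin n →₀ ℕ), IsBalanced G ∧ IsUpperSet G ∧
      symbolicPower (squarefreeVeronese K n d) k = monomialIdeal K G := by
  rcases le_or_gt d n with hdn | hdn
  · exact ⟨_, symbolicExponents_isBalanced d k, symbolicExponents_isUpperSet d k,
      symbolicPower_squarefreeVeronese hdn k⟩
  · refine ⟨∅, fun _ _ _ _ h => h.elim, isUpperSet_empty, ?_⟩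
    rw [squarefreeVeronese_eq_bot hdn, symbolicPower_bot (by omega), monomialIdeal,
      Set.image_empty, Ideal.span_empty]

theorem regularity_symbolicPower {d k : ℕ} (hdn : d ≤ n) :
    regularity (symbolicPower (squarefreeVeronese K n d) k) = ((d * k : ℕ) : EReal) := by
  rw [symbolicPower_squarefreeVeronese hdn]
  exact (symbolicExponents_isBalanced d k).regularity_eq (symbolicExponents_isUpperSet d k)
    (fun a ha => degree_le_of_minimal_symbolicExponents ha)
    (exists_minimal_symbolicExponents hdn)

theorem regularity_squarefreeVeronese_pow {d k : ℕ} (hdn : d ≤ n) :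
    regularity (squarefreeVeronese K n d ^ k) = ((d * k : ℕ) : EReal) := by
  classical
  rw [squarefreeVeronese_pow, ← monomialIdeal_upperClosure]
  refine (veroneseType_isBalanced d k).upperClosure.regularity_eq (upperClosure _).upper
    (fun a ha => (minimal_upperClosure_subset ha).1.le) ?_
  obtain ⟨T, -, hT⟩ := Finset.exists_subset_card_eq
    (show d ≤ (Finset.univ : Finset (Fin n)).card by simpa using hdn)
  have hmem : k • indicatorVector T ∈ veroneseType n d k := by
    refine ⟨by rw [map_nsmul, degree_indicatorVector, hT, smul_eq_mul, mul_comm], fun i => ?_⟩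
    rw [Finsupp.smul_apply, indicatorVector_apply]
    split_ifs <;> simp
  obtain ⟨b, -, hb⟩ := exists_minimal_le (subset_upperClosure hmem)
  exact ⟨b, hb, (minimal_upperClosure_subset hb).1⟩

end Veronese

theorem corollary3p3 {K : Type*} [Field K] (n d : ℕ) (hd : 1 ≤ d) :
    (∀ k : ℕ, 1 ≤ k →
      HasLinearQuotients (symbolicPower (squarefreeVeronese K n d) k) ∧
      IsComponentwiseLinear (symbolicPower (squarefreeVeronese K n d) k)) ∧
    (d ≤ n → ∀ k : ℕ, 1 ≤ k →
      regularity (symbolicPower (squarefreeVeronese K n d) k) =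
        regularity (squarefreeVeronese K n d ^ k) ∧
      regularity (squarefreeVeronese K n d ^ k) = ((d * k : ℕ) : EReal)) := by
  refine ⟨fun k hk => ?_, fun hdn k _ => ?_⟩
  · obtain ⟨G, hG, hup, h⟩ := exists_symbolicPower_eq (K := K) (n := n) d hk
    rw [h]
    exact ⟨hG.hasLinearQuotients hup, hG.isComponentwiseLinear hup⟩
  · rw [regularity_symbolicPower hdn, regularity_squarefreeVeronese_pow hdn]
    exact ⟨rfl, rfl⟩
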